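/- **Setting.** Let $d\ge 2$ and $r\in\mathbb C$. Let $\hat{\mathfrak h}$ be the complex Lie algebra with basis $\{v^i(m)\mid 1\le i\le d,\ m\in\mathbb Z\}\cup\{\mathbf c\}$, where $\mathbf c$ is central and $[v^i(m),v^j(n)]=\delta_{m+n,0}\,\delta_{i,j}\,m\,\mathbf c$. In $A=U(\hat{\mathfrak h})/\langle \mathbf c-1\rangle$ put $v^{ij}(m,n)=v^i(m)v^j(n)$, let $$\mathcal B=\{v^{ii}(m,n)\mid m\le n\}\cup\{v^{ij}(m,n)\mid i<j\},$$ and let $\mathcal L=\operatorname{Span}\mathcal B\oplus\mathbb C\subset A$, with projections $\pi_1:\mathcal L\to \operatorname{Span}\mathcal B$ and $\pi_2:\mathcal L\to\mathbb C$. Then $\mathcal L_r$ is the vector space $\mathcal L$ with the Lie bracket $[x,y]_r=\pi_1(xy-yx)+r\,\pi_2(xy-yx)$. Let $\mathcal B_+$ be the set of those $v^{ij}(m,n)\in\mathcal B$ with $m\ge 0$ or $n\ge 0$, let $\mathcal L_r^+=\operatorname{Span}\mathcal B_+\oplus\mathbb C$ (a Lie subalgebra), let $\mathbb C\mathbf 1$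 be the one-dimensional $\mathcal L_r^+$-module on which every $x\in\mathcal B_+$ acts as $0$ and every $s\in\mathbb C$ acts as $s$, and let $M_r=U(\mathcal L_r)\otimes_{U(\mathcal L_r^+)}\mathbb C\mathbf 1$. Write $v(m,n)=v^{11}(m,n)$. Let $\mathcal L_r^{(1)}$ be the Lie subalgebra of $\mathcal L_r$ generated by the $v(m,n)$ with $m\le n$, and let $M_r^{(1)}=U(\mathcal L_r^{(1)})\mathbf 1\subset M_r$. For $1\le k\le d$ and $l<0$ put $h_{k,l}=-\frac1l v^{kk}(l,-l)\in\mathcal L_r$. A *singular vector* of $M_r^{(1)}$ is a nonzero $u\in M_r^{(1)}$ such that * $u$ is homogeneous of a nonzero weight: there are integers $a_l\ge 0$ ($l<0$), finitely many but at least one of them nonzero, with $h_{1,l}u=a_lu$ for all $l<0$ and $h_{k,l}u=0$ for all $k\ge 2$ and $l<0$; * $v(m,n)u=0$ for all $m,n\in\mathbb Z$ with $m+n>0$. For $p\ge 1$ let $\mathbf V_p=(v(-s,-t))_{1\le s,t\le p}$. Its entries commute with each other, so that its determinant $$\det \mathbf V_p=\sum_{\sigma\in\mathfrak S_p}\operatorname{sgn}(\sigma)\prod_{1\le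 q\le p}v(-q,-\sigma(q))$$ is well defined in the enveloping algebra. **Proposition.** Let $r\in\mathbb Z$, and let $p,\nu\ge 1$ be integers with $r=1-2\nu+p$. Then $(\det\mathbf V_p)^{\nu}\mathbf 1$ is a singular vector of $M_r^{(1)}$. Moreover, the $\mathcal L_r^{(1)}$-module $M_r^{(1)}$ is reducible. -/

import Mathlib

open scoped TensorProduct

namespace JordanVOA

noncomputable section

attribute [local instance 100] LieRing.ofAssociativeRing

/-! ### The Heisenberg Lie algebra -/

/-- The bilinear form on the span of the `v^i(m)` with
`⟨v^i(m), v^j(n)⟩ = δ_{m+n,0} δ_{i,j} m`. -/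
def heisForm (d : ℕ) : (Fin d × ℤ →₀ ℂ) →ₗ[ℂ] (Fin d × ℤ →₀ ℂ) →ₗ[ℂ] ℂ :=
  Finsupp.lsum ℂ fun a => LinearMap.toSpanSingleton ℂ _
    ((a.2 : ℂ) • (Finsupp.lapply (a.1, -a.2) : (Fin d × ℤ →₀ ℂ) →ₗ[ℂ] ℂ))

theorem heisForm_single (d : ℕ) (a b : Fin d × ℤ) :
    heisForm d (Finsupp.single a 1) (Finsupp.single b 1) =
      if a.1 = b.1 ∧ a.2 + b.2 = 0 then (a.2 : ℂ) else 0 := by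
  obtain ⟨i, m⟩ := a
  obtain ⟨j, n⟩ := b
  simp only [heisForm, Finsupp.lsum_single, LinearMap.toSpanSingleton_apply, one_smul,
    LinearMap.smul_apply, Finsupp.lapply_apply, smul_eq_mul, Finsupp.single_apply, Prod.mk.injEq]
  by_cases h : i = j ∧ m + n = 0
  · rw [if_pos h, if_pos ⟨h.1.symm, by omega⟩, mul_one]
  · rw [if_neg h, if_neg (fun h' => h ⟨h'.1.symm, by omega⟩), mul_zero]

theorem heisForm_flip (d : ℕ) : (heisForm d).flip = -heisForm d := by
  ext a b
  have h1 := heisForm_single d a b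
  have h2 := heisForm_single d b a
  simp only [LinearMap.comp_apply, LinearMap.flip_apply, LinearMap.neg_apply,
    Finsupp.lsingle_apply, h1, h2]
  by_cases h : a.1 = b.1 ∧ a.2 + b.2 = 0
  · rw [if_pos h, if_pos ⟨h.1.symm, by omega⟩]
    have : b.2 = -a.2 := by omega
    rw [this]; push_cast; ring
  · rw [if_neg h, if_neg (fun h' => h ⟨h'.1.symm, by omega⟩), neg_zero]

theorem heisForm_self (d : ℕ) (f : Fin d × ℤ →₀ ℂ) : heisForm d f f = 0 := by
  have h := congrArg (fun φ => φ f f) (heisForm_flip d)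
  simp only [LinearMap.flip_apply, LinearMap.neg_apply] at h
  exact self_eq_neg.mp h

/-- The Lie algebra with linear basis `v^i(m)` (for `i : Fin d`, `m : ℤ`) and `c`. -/
def Heis (d : ℕ) : Type := (Fin d × ℤ →₀ ℂ) × ℂ

instance (d : ℕ) : AddCommGroup (Heis d) :=
  inferInstanceAs (AddCommGroup ((Fin d × ℤ →₀ ℂ) × ℂ))

instance (d : ℕ) : Module ℂ (Heis d) :=
  inferInstanceAs (Module ℂ ((Fin d × ℤ →₀ ℂ) × ℂ))

instance (d : ℕ) : Bracket (Heis d) (Heis d) :=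
  ⟨fun x y => ((0, heisForm d x.1 y.1) : (Fin d × ℤ →₀ ℂ) × ℂ)⟩

theorem Heis.lie_def {d : ℕ} (x y : Heis d) :
    ⁅x, y⁆ = ((0, heisForm d x.1 y.1) : (Fin d × ℤ →₀ ℂ) × ℂ) := rfl

instance (d : ℕ) : LieRing (Heis d) where
  add_lie x y z := by
    refine Prod.ext ?_ ?_
    · exact (add_zero (0 : Fin d × ℤ →₀ ℂ)).symm
    · exact congrArg (fun φ => φ z.1) (map_add (heisForm d) x.1 y.1)
  lie_add x y z := by
    refine Prod.ext ?_ ?_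
    · exact (add_zero (0 : Fin d × ℤ →₀ ℂ)).symm
    · exact map_add (heisForm d x.1) y.1 z.1
  lie_self x := Prod.ext rfl (heisForm_self d x.1)
  leibniz_lie x y z := by
    refine Prod.ext ?_ ?_
    · exact (add_zero (0 : Fin d × ℤ →₀ ℂ)).symm
    · change heisForm d x.1 0 = heisForm d 0 z.1 + heisForm d y.1 0
      simp

instance (d : ℕ) : LieAlgebra ℂ (Heis d) where
  lie_smul t x y := by
    refine Prod.ext ?_ ?_
    · exact (smul_zero t).symm
    · exact map_smul (heisForm d x.1) t y.1

/-- The basis vector `v^i(m)`. -/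
def Heis.v {d : ℕ} (i : Fin d) (m : ℤ) : Heis d :=
  ((Finsupp.single (i, m) 1, 0) : (Fin d × ℤ →₀ ℂ) × ℂ)

/-- The central basis vector. -/
def Heis.c {d : ℕ} : Heis d := ((0, 1) : (Fin d × ℤ →₀ ℂ) × ℂ)

theorem Heis.lie_v {d : ℕ} (i j : Fin d) (m n : ℤ) :
    ⁅Heis.v i m, Heis.v j n⁆ =
      (if i = j ∧ m + n = 0 then (m : ℂ) else 0) • (Heis.c : Heis d) := by
  rw [Heis.lie_def]
  refine Prod.ext ?_ ?_
  · exact (smul_zero _).symm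
  · exact (heisForm_single d (i, m) (j, n)).trans (mul_one _).symm

/-- The relation `c = 1` on the universal enveloping algebra. -/
inductive HeisRel (d : ℕ) : UniversalEnvelopingAlgebra ℂ (Heis d) →
    UniversalEnvelopingAlgebra ℂ (Heis d) → Prop
  | c_eq_one : HeisRel d (UniversalEnvelopingAlgebra.ι ℂ Heis.c) 1

/-- The quotient of the universal enveloping algebra of the Heisenberg Lie algebra by the
two-sided ideal generated by `c - 1`. -/
def HeisAlg (d : ℕ) : Type := RingQuot (HeisRel d)

instance (d : ℕ) : Ring (HeisAlg d) := inferInstanceAs (Ring (RingQuot (HeisRel d)))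

instance (d : ℕ) : Algebra ℂ (HeisAlg d) := inferInstanceAs (Algebra ℂ (RingQuot (HeisRel d)))

/-- The quotient map. -/
def HeisAlg.mk (d : ℕ) : UniversalEnvelopingAlgebra ℂ (Heis d) →ₐ[ℂ] HeisAlg d :=
  RingQuot.mkAlgHom ℂ (HeisRel d)

/-- The image of `v^i(m)` in the quotient algebra. -/
def gen {d : ℕ} (i : Fin d) (m : ℤ) : HeisAlg d :=
  HeisAlg.mk d (UniversalEnvelopingAlgebra.ι ℂ (Heis.v i m))

theorem mk_c (d : ℕ) : HeisAlg.mk d (UniversalEnvelopingAlgebra.ι ℂ Heis.c) = 1 := by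
  rw [← map_one (HeisAlg.mk d)]
  exact RingQuot.mkAlgHom_rel ℂ HeisRel.c_eq_one

theorem gen_comm {d : ℕ} (i j : Fin d) (m n : ℤ) :
    gen i m * gen j n = gen j n * gen i m +
      algebraMap ℂ (HeisAlg d) (if i = j ∧ m + n = 0 then (m : ℂ) else 0) := by
  have h : gen i m * gen j n - gen j n * gen i m =
      HeisAlg.mk d (UniversalEnvelopingAlgebra.ι ℂ ⁅Heis.v i m, Heis.v j n⁆) := by
    rw [LieHom.map_lie, LieRing.of_associative_ring_bracket, map_sub, map_mul, map_mul]
    rfl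
  rw [Heis.lie_v, map_smul, map_smul, mk_c, ← Algebra.algebraMap_eq_smul_one] at h
  rw [← h]; abel

/-- `v^{ij}(m,n) = v^i(m) v^j(n)`. -/
def quad {d : ℕ} (i j : Fin d) (m n : ℤ) : HeisAlg d := gen i m * gen j n

/-- The set `𝓑` of normally ordered quadratic elements. -/
def setB (d : ℕ) : Set (HeisAlg d) :=
  {x | ∃ (i : Fin d) (m n : ℤ), m ≤ n ∧ x = quad i i m n} ∪
  {x | ∃ (i j : Fin d) (m n : ℤ), i < j ∧ x = quad i j m n}

/-- The set `𝓑₊` of those `v^{ij}(m,n) ∈ 𝓑` with `m ≥ 0` or `n ≥ 0`. -/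
def setBPlus (d : ℕ) : Set (HeisAlg d) :=
  {x | ∃ (i : Fin d) (m n : ℤ), m ≤ n ∧ (0 ≤ m ∨ 0 ≤ n) ∧ x = quad i i m n} ∪
  {x | ∃ (i j : Fin d) (m n : ℤ), i < j ∧ (0 ≤ m ∨ 0 ≤ n) ∧ x = quad i j m n}

/-- The subspace `Span 𝓑 + ℂ` of the quotient algebra. -/
def spaceL (d : ℕ) : Submodule ℂ (HeisAlg d) :=
  Submodule.span ℂ (setB d) ⊔ Submodule.span ℂ {1}

/-- The subspace `Span 𝓑₊ + ℂ` of the quotient algebra. -/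
def spaceLPlus (d : ℕ) : Submodule ℂ (HeisAlg d) :=
  Submodule.span ℂ (setBPlus d) ⊔ Submodule.span ℂ {1}

theorem algebraMap_mem_spaceL {d : ℕ} (z : ℂ) : algebraMap ℂ (HeisAlg d) z ∈ spaceL d := by
  rw [Algebra.algebraMap_eq_smul_one]
  exact Submodule.mem_sup_right (Submodule.smul_mem _ _ (Submodule.mem_span_singleton_self _))

theorem algebraMap_mem_spaceLPlus {d : ℕ} (z : ℂ) :
    algebraMap ℂ (HeisAlg d) z ∈ spaceLPlus d := by
  rw [Algebra.algebraMap_eq_smul_one]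
  exact Submodule.mem_sup_right (Submodule.smul_mem _ _ (Submodule.mem_span_singleton_self _))

theorem quad_swap {d : ℕ} (i j : Fin d) (m n : ℤ) : quad i j m n = quad j i n m +
      algebraMap ℂ (HeisAlg d) (if i = j ∧ m + n = 0 then (m : ℂ) else 0) :=
  gen_comm i j m n

theorem quad_mem {d : ℕ} (i j : Fin d) (m n : ℤ) : quad i j m n ∈ spaceL d := by
  have key : ∀ (i j : Fin d) (m n : ℤ), (i < j ∨ (i = j ∧ m ≤ n)) → quad i j m n ∈ spaceL d := by
    rintro i j m n (h | ⟨rfl, h⟩)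
    · exact Submodule.mem_sup_left (Submodule.subset_span (Or.inr ⟨i, j, m, n, h, rfl⟩))
    · exact Submodule.mem_sup_left (Submodule.subset_span (Or.inl ⟨i, m, n, h, rfl⟩))
  by_cases h : i < j ∨ (i = j ∧ m ≤ n)
  · exact key i j m n h
  · rw [quad_swap]
    refine add_mem (key j i n m ?_) (algebraMap_mem_spaceL _)
    rcases lt_trichotomy i j with h' | h' | h'
    · exact absurd (Or.inl h') h
    · exact Or.inr ⟨h'.symm, by by_contra hc; exact h (Or.inr ⟨h', by omega⟩)⟩
    · exact Or.inl h'

theorem quad_mem_plus {d : ℕ} (i j : Fin d) (m n : ℤ) (hmn : 0 ≤ m ∨ 0 ≤ n) :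
    quad i j m n ∈ spaceLPlus d := by
  have key : ∀ (i j : Fin d) (m n : ℤ), (0 ≤ m ∨ 0 ≤ n) → (i < j ∨ (i = j ∧ m ≤ n)) →
      quad i j m n ∈ spaceLPlus d := by
    rintro i j m n hmn (h | ⟨rfl, h⟩)
    · exact Submodule.mem_sup_left (Submodule.subset_span (Or.inr ⟨i, j, m, n, h, hmn, rfl⟩))
    · exact Submodule.mem_sup_left (Submodule.subset_span (Or.inl ⟨i, m, n, h, hmn, rfl⟩))
  by_cases h : i < j ∨ (i = j ∧ m ≤ n)
  · exact key i j m n hmn h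
  · rw [quad_swap]
    refine add_mem (key j i n m hmn.symm ?_) (algebraMap_mem_spaceLPlus _)
    rcases lt_trichotomy i j with h' | h' | h'
    · exact absurd (Or.inl h') h
    · exact Or.inr ⟨h'.symm, by by_contra hc; exact h (Or.inr ⟨h', by omega⟩)⟩
    · exact Or.inl h'

/-- The contraction `[v^i(m), v^j(n)]`. -/
def contr {d : ℕ} (i j : Fin d) (m n : ℤ) : ℂ := if i = j ∧ m + n = 0 then (m : ℂ) else 0

theorem quad_comm {d : ℕ} (i j k l : Fin d) (m n s t : ℤ) :
    quad i j m n * quad k l s t - quad k l s t * quad i j m n =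
      contr j k n s • quad i l m t + contr i k m s • quad j l n t
        + contr j l n t • quad k i s m + contr i l m t • quad k j s n := by
  have h1 : gen i m * gen k s = gen k s * gen i m + contr i k m s • (1 : HeisAlg d) := by
    rw [gen_comm, Algebra.algebraMap_eq_smul_one]; rfl
  have h2 : gen i m * gen l t = gen l t * gen i m + contr i l m t • (1 : HeisAlg d) := by
    rw [gen_comm, Algebra.algebraMap_eq_smul_one]; rfl
  have h3 : gen j n * gen k s = gen k s * gen j n + contr j k n s • (1 : HeisAlg d) := by
    rw [gen_comm, Algebra.algebraMap_eq_smul_one]; rfl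
  have h4 : gen j n * gen l t = gen l t * gen j n + contr j l n t • (1 : HeisAlg d) := by
    rw [gen_comm, Algebra.algebraMap_eq_smul_one]; rfl
  simp only [quad]
  have e : gen i m * gen j n * (gen k s * gen l t) - gen k s * gen l t * (gen i m * gen j n) =
      gen i m * (gen j n * gen k s - gen k s * gen j n) * gen l t
      + (gen i m * gen k s - gen k s * gen i m) * (gen j n * gen l t)
      + gen k s * gen i m * (gen j n * gen l t - gen l t * gen j n)
      + gen k s * (gen i m * gen l t - gen l t * gen i m) * gen j n := by noncomm_ring
  rw [e, sub_eq_of_eq_add' h1, sub_eq_of_eq_add' h2, sub_eq_of_eq_add' h3,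
    sub_eq_of_eq_add' h4]
  simp only [mul_smul_comm, smul_mul_assoc, mul_one, one_mul]

theorem comm_mem {d : ℕ} (S : Set (HeisAlg d)) (N : Submodule ℂ (HeisAlg d))
    (h : ∀ x ∈ S, ∀ y ∈ S, x * y - y * x ∈ N) {x y : HeisAlg d}
    (hx : x ∈ Submodule.span ℂ S ⊔ Submodule.span ℂ {1})
    (hy : y ∈ Submodule.span ℂ S ⊔ Submodule.span ℂ {1}) : x * y - y * x ∈ N := by
  rw [← Submodule.span_union] at hx hy
  induction hx using Submodule.span_induction with
  | zero => simp
  | add a b _ _ ha hb =>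
    have : (a + b) * y - y * (a + b) = (a * y - y * a) + (b * y - y * b) := by noncomm_ring
    rw [this]; exact add_mem ha hb
  | smul t a _ ha =>
    rw [smul_mul_assoc, mul_smul_comm, ← smul_sub]; exact N.smul_mem t ha
  | mem a ha =>
    induction hy using Submodule.span_induction with
    | zero => simp
    | add b c _ _ hb hc =>
      have : a * (b + c) - (b + c) * a = (a * b - b * a) + (a * c - c * a) := by noncomm_ring
      rw [this]; exact add_mem hb hc
    | smul t b _ hb =>
      rw [smul_mul_assoc, mul_smul_comm, ← smul_sub]; exact N.smul_mem t hb
    | mem b hb =>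
      rcases ha with ha | ha
      · rcases hb with hb | hb
        · exact h a ha b hb
        · rw [Set.mem_singleton_iff.mp hb]; simp
      · rw [Set.mem_singleton_iff.mp ha]; simp

theorem setB_eq_quad {d : ℕ} {x : HeisAlg d} (hx : x ∈ setB d) :
    ∃ i j m n, x = quad i j m n := by
  rcases hx with ⟨i, m, n, _, rfl⟩ | ⟨i, j, m, n, _, rfl⟩
  · exact ⟨i, i, m, n, rfl⟩
  · exact ⟨i, j, m, n, rfl⟩

theorem setBPlus_eq_quad {d : ℕ} {x : HeisAlg d} (hx : x ∈ setBPlus d) :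
    ∃ i j m n, (0 ≤ m ∨ 0 ≤ n) ∧ x = quad i j m n := by
  rcases hx with ⟨i, m, n, _, h, rfl⟩ | ⟨i, j, m, n, _, h, rfl⟩
  · exact ⟨i, i, m, n, h, rfl⟩
  · exact ⟨i, j, m, n, h, rfl⟩

theorem setBPlus_subset (d : ℕ) : setBPlus d ⊆ setB d := by
  rintro x (⟨i, m, n, h, _, rfl⟩ | ⟨i, j, m, n, h, _, rfl⟩)
  · exact Or.inl ⟨i, m, n, h, rfl⟩
  · exact Or.inr ⟨i, j, m, n, h, rfl⟩

theorem spaceL_comm_mem {d : ℕ} {x y : HeisAlg d} (hx : x ∈ spaceL d) (hy : y ∈ spaceL d) :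
    x * y - y * x ∈ spaceL d := by
  refine comm_mem (setB d) (spaceL d) ?_ hx hy
  intro a ha b hb
  obtain ⟨i, j, m, n, rfl⟩ := setB_eq_quad ha
  obtain ⟨k, l, s, t, rfl⟩ := setB_eq_quad hb
  rw [quad_comm]
  exact add_mem (add_mem (add_mem (Submodule.smul_mem _ _ (quad_mem _ _ _ _))
    (Submodule.smul_mem _ _ (quad_mem _ _ _ _))) (Submodule.smul_mem _ _ (quad_mem _ _ _ _)))
    (Submodule.smul_mem _ _ (quad_mem _ _ _ _))

theorem contr_smul_quad_mem_plus {d : ℕ} (i j k l : Fin d) (m n s t : ℤ)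
    (h : m + n = 0 → m ≠ 0 → 0 ≤ s ∨ 0 ≤ t) :
    contr i j m n • quad k l s t ∈ spaceLPlus d := by
  by_cases h0 : contr i j m n = 0
  · rw [h0, zero_smul]; exact zero_mem _
  · refine Submodule.smul_mem _ _ (quad_mem_plus k l s t ?_)
    simp only [contr, ite_eq_right_iff, Int.cast_eq_zero, not_forall] at h0
    exact h h0.1.2 h0.2

theorem spaceLPlus_comm_mem {d : ℕ} {x y : HeisAlg d} (hx : x ∈ spaceLPlus d)
    (hy : y ∈ spaceLPlus d) : x * y - y * x ∈ spaceLPlus d := by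
  refine comm_mem (setBPlus d) (spaceLPlus d) ?_ hx hy
  intro a ha b hb
  obtain ⟨i, j, m, n, h1, rfl⟩ := setBPlus_eq_quad ha
  obtain ⟨k, l, s, t, h2, rfl⟩ := setBPlus_eq_quad hb
  rw [quad_comm]
  refine add_mem (add_mem (add_mem ?_ ?_) ?_) ?_ <;>
    exact contr_smul_quad_mem_plus _ _ _ _ _ _ _ _ (by omega)

/-! ### The sum `Span 𝓑 + ℂ` is direct

This is seen on polynomials in variables `x_{i,m}`, `m < 0`, where `v^i(m)` acts as
multiplication by `x_{i,m}` for `m < 0` and as `m ∂/∂x_{i,-m}` for `m ≥ 0`. -/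

/-- The operator by which `v^i(m)` acts on polynomials. -/
def fockGen (d : ℕ) (a : Fin d × ℤ) : Module.End ℂ (MvPolynomial (Fin d × ℤ) ℂ) :=
  if a.2 < 0 then LinearMap.mulLeft ℂ (MvPolynomial.X a)
  else (a.2 : ℂ) • (MvPolynomial.pderiv (a.1, -a.2) :
    Derivation ℂ (MvPolynomial (Fin d × ℤ) ℂ) (MvPolynomial (Fin d × ℤ) ℂ)).toLinearMap

theorem pderiv_comm' {d : ℕ} (a b : Fin d × ℤ) (f : MvPolynomial (Fin d × ℤ) ℂ) :
    MvPolynomial.pderiv a (MvPolynomial.pderiv b f) =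
      MvPolynomial.pderiv b (MvPolynomial.pderiv a f) := by
  have h : ⁅(MvPolynomial.pderiv a :
        Derivation ℂ (MvPolynomial (Fin d × ℤ) ℂ) (MvPolynomial (Fin d × ℤ) ℂ)),
      (MvPolynomial.pderiv b :
        Derivation ℂ (MvPolynomial (Fin d × ℤ) ℂ) (MvPolynomial (Fin d × ℤ) ℂ))⁆ = 0 := by
    apply MvPolynomial.derivation_ext
    intro i
    simp [Derivation.commutator_apply, MvPolynomial.pderiv_X, Pi.single_apply, apply_ite]
  have h' := congrArg (fun D : Derivation ℂ (MvPolynomial (Fin d × ℤ) ℂ)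
    (MvPolynomial (Fin d × ℤ) ℂ) => D f) h
  simpa [Derivation.commutator_apply, sub_eq_zero] using h'

theorem fockGen_comm (d : ℕ) (a b : Fin d × ℤ) :
    fockGen d a * fockGen d b - fockGen d b * fockGen d a =
      heisForm d (Finsupp.single a 1) (Finsupp.single b 1) • 1 := by
  obtain ⟨i, m⟩ := a
  obtain ⟨j, n⟩ := b
  rw [heisForm_single]
  refine LinearMap.ext fun f => ?_
  by_cases hm : m < 0 <;> by_cases hn : n < 0
  · rw [if_neg (by dsimp only; omega)]
    simp [fockGen, hm, hn]
    ring
  · simp only [fockGen, hm, hn, if_true, if_false, LinearMap.sub_apply, Module.End.mul_apply,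
      LinearMap.mulLeft_apply, LinearMap.smul_apply, Derivation.coeFn_coe, Derivation.leibniz,
      MvPolynomial.pderiv_X, Module.End.one_apply, smul_eq_mul, Pi.single_apply, Prod.mk.injEq]
    by_cases h : i = j ∧ m + n = 0
    · rw [if_pos h, if_pos ⟨h.1, by omega⟩]
      have : (n : ℂ) = -m := by exact_mod_cast (by omega : n = -m)
      rw [this]
      simp only [MvPolynomial.smul_eq_C_mul, map_neg]
      ring
    · rw [if_neg h, if_neg (fun h' => h ⟨h'.1, by omega⟩)]
      simp only [MvPolynomial.smul_eq_C_mul, map_zero]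
      ring
  · simp only [fockGen, hm, hn, if_true, if_false, LinearMap.sub_apply, Module.End.mul_apply,
      LinearMap.mulLeft_apply, LinearMap.smul_apply, Derivation.coeFn_coe, Derivation.leibniz,
      MvPolynomial.pderiv_X, Module.End.one_apply, smul_eq_mul, Pi.single_apply, Prod.mk.injEq]
    by_cases h : i = j ∧ m + n = 0
    · rw [if_pos h, if_pos ⟨h.1.symm, by omega⟩]
      simp only [MvPolynomial.smul_eq_C_mul]
      ring
    · rw [if_neg h, if_neg (fun h' => h ⟨h'.1.symm, by omega⟩)]
      simp only [MvPolynomial.smul_eq_C_mul, map_zero]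
      ring
  · have hz : (if i = j ∧ m + n = 0 then (m : ℂ) else 0) = 0 := by
      split_ifs with h
      · exact_mod_cast (by omega : m = 0)
      · rfl
    rw [hz]
    simp [fockGen, hm, hn, pderiv_comm' (i, -m) (j, -n), smul_comm (m : ℂ) (n : ℂ)]

/-- The linear extension of `fockGen`. -/
def fockLin (d : ℕ) : (Fin d × ℤ →₀ ℂ) →ₗ[ℂ] Module.End ℂ (MvPolynomial (Fin d × ℤ) ℂ) :=
  Finsupp.lsum ℂ fun a => LinearMap.toSpanSingleton ℂ _ (fockGen d a)

theorem fockLin_single {d : ℕ} (a : Fin d × ℤ) (z : ℂ) :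
    fockLin d (Finsupp.single a z) = z • fockGen d a := by
  simp [fockLin]

theorem fockLin_comm (d : ℕ) (f g : Fin d × ℤ →₀ ℂ) :
    fockLin d f * fockLin d g - fockLin d g * fockLin d f = heisForm d f g • 1 := by
  induction f using Finsupp.induction_linear with
  | zero => simp
  | add f₁ f₂ h₁ h₂ =>
    have e : fockLin d (f₁ + f₂) * fockLin d g - fockLin d g * fockLin d (f₁ + f₂) =
        (fockLin d f₁ * fockLin d g - fockLin d g * fockLin d f₁) +
        (fockLin d f₂ * fockLin d g - fockLin d g * fockLin d f₂) := by
      rw [map_add]; noncomm_ring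
    rw [e, h₁, h₂, map_add, LinearMap.add_apply, add_smul]
  | single a z =>
    induction g using Finsupp.induction_linear with
    | zero => simp
    | add g₁ g₂ h₁ h₂ =>
      have e : fockLin d (Finsupp.single a z) * fockLin d (g₁ + g₂) -
          fockLin d (g₁ + g₂) * fockLin d (Finsupp.single a z) =
          (fockLin d (Finsupp.single a z) * fockLin d g₁ -
            fockLin d g₁ * fockLin d (Finsupp.single a z)) +
          (fockLin d (Finsupp.single a z) * fockLin d g₂ -
            fockLin d g₂ * fockLin d (Finsupp.single a z)) := by
        rw [map_add]; noncomm_ring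
      rw [e, h₁, h₂, map_add, add_smul]
    | single b w =>
      have ha : Finsupp.single a z = z • Finsupp.single a (1 : ℂ) := by simp
      have hb : Finsupp.single b w = w • Finsupp.single b (1 : ℂ) := by simp
      rw [fockLin_single, fockLin_single, smul_mul_smul_comm, smul_mul_smul_comm, mul_comm w z,
        sub_eq_iff_eq_add.mp (fockGen_comm d a b), smul_add, add_sub_cancel_right, ha, hb,
        map_smul, map_smul, LinearMap.smul_apply, smul_smul, smul_eq_mul, smul_eq_mul]
      congr 1
      ring

/-- The action of the Heisenberg Lie algebra on polynomials, with `c` acting as `1`. -/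
def fockHom (d : ℕ) : Heis d →ₗ⁅ℂ⁆ Module.End ℂ (MvPolynomial (Fin d × ℤ) ℂ) :=
  { (LinearMap.coprod (fockLin d) (LinearMap.toSpanSingleton ℂ _ 1) :
      ((Fin d × ℤ →₀ ℂ) × ℂ) →ₗ[ℂ] Module.End ℂ (MvPolynomial (Fin d × ℤ) ℂ)) with
    map_lie' := by
      rintro ⟨f, s⟩ ⟨g, t⟩
      change LinearMap.coprod _ _ ((0, heisForm d f g) : (Fin d × ℤ →₀ ℂ) × ℂ) =
        ⁅LinearMap.coprod _ _ (f, s), LinearMap.coprod _ _ (g, t)⁆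
      simp only [LinearMap.coprod_apply, map_zero, zero_add, LinearMap.toSpanSingleton_apply]
      rw [← fockLin_comm, LieRing.of_associative_ring_bracket]
      simp only [add_mul, mul_add, smul_mul_assoc, mul_smul_comm, one_mul, mul_one,
        smul_add, smul_comm s t]
      abel }

theorem fockHom_v {d : ℕ} (i : Fin d) (m : ℤ) : fockHom d (Heis.v i m) = fockGen d (i, m) := by
  change LinearMap.coprod _ _ ((Finsupp.single (i, m) 1, 0) : (Fin d × ℤ →₀ ℂ) × ℂ) = _
  simp [fockLin_single]

theorem fockHom_c (d : ℕ) : fockHom d Heis.c = 1 := by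
  change LinearMap.coprod _ _ ((0, 1) : (Fin d × ℤ →₀ ℂ) × ℂ) = _
  simp

/-- The action of the quotient algebra on polynomials. -/
def fock (d : ℕ) : HeisAlg d →ₐ[ℂ] Module.End ℂ (MvPolynomial (Fin d × ℤ) ℂ) :=
  RingQuot.liftAlgHom ℂ ⟨UniversalEnvelopingAlgebra.lift ℂ (fockHom d), by
    rintro _ _ ⟨⟩
    rw [UniversalEnvelopingAlgebra.lift_ι_apply, fockHom_c, map_one]⟩

theorem fock_gen {d : ℕ} (i : Fin d) (m : ℤ) : fock d (gen i m) = fockGen d (i, m) := by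
  rw [← fockHom_v, ← UniversalEnvelopingAlgebra.lift_ι_apply ℂ (fockHom d)]
  exact RingQuot.liftAlgHom_mkAlgHom_apply ℂ _ _ _

/-- The constant coefficient of `x · 1`. -/
def vacExp (d : ℕ) : HeisAlg d →ₗ[ℂ] ℂ :=
  (MvPolynomial.aeval (fun _ : Fin d × ℤ => (0 : ℂ))).toLinearMap ∘ₗ
    LinearMap.applyₗ (1 : MvPolynomial (Fin d × ℤ) ℂ) ∘ₗ (fock d).toLinearMap

theorem vacExp_apply {d : ℕ} (x : HeisAlg d) :
    vacExp d x = MvPolynomial.aeval (fun _ : Fin d × ℤ => (0 : ℂ)) (fock d x 1) := rfl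

theorem vacExp_one (d : ℕ) : vacExp d 1 = 1 := by
  simp [vacExp_apply]

theorem fock_quad_one_of_nonneg {d : ℕ} (i j : Fin d) (m n : ℤ) (h : 0 ≤ n) :
    fock d (quad i j m n) 1 = 0 := by
  rw [quad, map_mul, fock_gen, fock_gen, Module.End.mul_apply]
  have : fockGen d (j, n) 1 = 0 := by
    simp [fockGen, not_lt.mpr h]
  rw [this, map_zero]

theorem fock_quad_one_of_ne {d : ℕ} (i j : Fin d) (m n : ℤ) (hm : 0 ≤ m)
    (h : i ≠ j ∨ m + n ≠ 0) : fock d (quad i j m n) 1 = 0 := by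
  by_cases hn : 0 ≤ n
  · exact fock_quad_one_of_nonneg i j m n hn
  · rw [quad, map_mul, fock_gen, fock_gen, Module.End.mul_apply]
    have hx : MvPolynomial.pderiv (i, -m) (MvPolynomial.X (j, n) : MvPolynomial (Fin d × ℤ) ℂ)
        = 0 := by
      refine MvPolynomial.pderiv_X_of_ne ?_
      rw [Ne, Prod.mk.injEq]
      rintro ⟨h1, h2⟩
      rcases h with h | h
      · exact h h1.symm
      · omega
    simp [fockGen, not_lt.mpr hm, not_le.mp hn, hx]

theorem fock_one_of_mem_setBPlus {d : ℕ} {x : HeisAlg d} (hx : x ∈ setBPlus d) :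
    fock d x 1 = 0 := by
  rcases hx with ⟨i, m, n, hle, h, rfl⟩ | ⟨i, j, m, n, hlt, h, rfl⟩
  · exact fock_quad_one_of_nonneg _ _ _ _ (by omega)
  · rcases h with h | h
    · exact fock_quad_one_of_ne _ _ _ _ h (Or.inl hlt.ne)
    · exact fock_quad_one_of_nonneg _ _ _ _ h

theorem vacExp_of_mem_setB {d : ℕ} {x : HeisAlg d} (hx : x ∈ setB d) : vacExp d x = 0 := by
  by_cases hp : x ∈ setBPlus d
  · rw [vacExp_apply, fock_one_of_mem_setBPlus hp, map_zero]
  · have : ∃ i j m n, m < 0 ∧ n < 0 ∧ x = quad i j m n := by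
      rcases hx with ⟨i, m, n, hle, rfl⟩ | ⟨i, j, m, n, hlt, rfl⟩
      · refine ⟨i, i, m, n, ?_, ?_, rfl⟩ <;>
          · by_contra hc
            exact hp (Or.inl ⟨i, m, n, hle, by omega, rfl⟩)
      · refine ⟨i, j, m, n, ?_, ?_, rfl⟩ <;>
          · by_contra hc
            exact hp (Or.inr ⟨i, j, m, n, hlt, by omega, rfl⟩)
    obtain ⟨i, j, m, n, hm, hn, rfl⟩ := this
    rw [vacExp_apply, quad, map_mul, fock_gen, fock_gen, Module.End.mul_apply]
    simp [fockGen, hm, hn]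

theorem vacExp_of_mem_span {d : ℕ} {x : HeisAlg d} (hx : x ∈ Submodule.span ℂ (setB d)) :
    vacExp d x = 0 := by
  have : Submodule.span ℂ (setB d) ≤ LinearMap.ker (vacExp d) :=
    Submodule.span_le.mpr fun y hy => vacExp_of_mem_setB hy
  exact this hx

/-- `Span 𝓑` as a subspace of `Span 𝓑 + ℂ`. -/
def spanB (d : ℕ) : Submodule ℂ (spaceL d) :=
  (Submodule.span ℂ (setB d)).comap (spaceL d).subtype

/-- The element `1` of `Span 𝓑 + ℂ`. -/
def oneL (d : ℕ) : spaceL d :=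
  ⟨1, Submodule.mem_sup_right (Submodule.mem_span_singleton_self _)⟩

theorem oneL_ne_zero (d : ℕ) : oneL d ≠ 0 := by
  intro h
  have h' : (1 : HeisAlg d) = 0 := congrArg Subtype.val h
  have := vacExp_one d
  rw [h', map_zero] at this
  exact zero_ne_one this

theorem isCompl_spanB (d : ℕ) : IsCompl (spanB d) (Submodule.span ℂ {oneL d}) := by
  constructor
  · rw [Submodule.disjoint_def]
    intro x hx hx1
    obtain ⟨z, rfl⟩ := Submodule.mem_span_singleton.mp hx1
    have h0 : vacExp d (z • (1 : HeisAlg d)) = 0 := vacExp_of_mem_span hx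
    rw [map_smul, vacExp_one, smul_eq_mul, mul_one] at h0
    rw [h0, zero_smul]
  · rw [codisjoint_iff, Submodule.eq_top_iff']
    rintro ⟨x, hx⟩
    obtain ⟨b, hb, s, hs, hbs⟩ := Submodule.mem_sup.mp hx
    obtain ⟨z, hz⟩ := Submodule.mem_span_singleton.mp hs
    refine Submodule.mem_sup.mpr ⟨⟨b, Submodule.mem_sup_left hb⟩, hb, z • oneL d,
      Submodule.smul_mem _ _ (Submodule.mem_span_singleton_self _), ?_⟩
    apply Subtype.ext
    change b + z • (1 : HeisAlg d) = x
    rw [hz, hbs]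

/-- The projection `π₁` of `Span 𝓑 ⊕ ℂ` onto `Span 𝓑`. -/
def pi1 (d : ℕ) : spaceL d →ₗ[ℂ] spaceL d :=
  (spanB d).projection (Submodule.span ℂ {oneL d}) (isCompl_spanB d)

/-- The projection `π₂` of `Span 𝓑 ⊕ ℂ` onto `ℂ`. -/
def pi2 (d : ℕ) : spaceL d →ₗ[ℂ] ℂ :=
  (LinearEquiv.toSpanNonzeroSingleton ℂ (spaceL d) (oneL d) (oneL_ne_zero d)).symm.toLinearMap ∘ₗ
    (Submodule.span ℂ {oneL d}).projectionOnto (spanB d) (isCompl_spanB d).symm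

theorem pi1_add_pi2 {d : ℕ} (x : spaceL d) : pi1 d x + pi2 d x • oneL d = x := by
  have h1 : pi2 d x • oneL d =
      (Submodule.span ℂ {oneL d}).projection (spanB d) (isCompl_spanB d).symm x :=
    LinearEquiv.toSpanNonzeroSingleton_symm_apply_smul ℂ (spaceL d) (oneL d) (oneL_ne_zero d) _
  rw [h1]
  exact Submodule.projection_add_projection_eq_self (isCompl_spanB d) x

theorem pi2_eq_vacExp {d : ℕ} (x : spaceL d) : pi2 d x = vacExp d x := by
  have h := congrArg (fun y : spaceL d => vacExp d y) (pi1_add_pi2 x)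
  have h0 : vacExp d (pi1 d x : HeisAlg d) = 0 :=
    vacExp_of_mem_span (((spanB d).projectionOnto _ (isCompl_spanB d) x).2)
  have h1 : vacExp d ((pi1 d x + pi2 d x • oneL d : spaceL d) : HeisAlg d) = pi2 d x := by
    change vacExp d ((pi1 d x : HeisAlg d) + pi2 d x • (1 : HeisAlg d)) = _
    rw [map_add, h0, map_smul, vacExp_one, zero_add, smul_eq_mul, mul_one]
  exact h1.symm.trans h

/-! ### The Lie algebra `𝓛_r` -/

/-- The vector space `𝓛 = Span 𝓑 ⊕ ℂ`, to be equipped with the bracket `[·,·]_r`. -/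
def Lr (d : ℕ) (_r : ℂ) : Type := spaceL d

instance (d : ℕ) (r : ℂ) : AddCommGroup (Lr d r) := inferInstanceAs (AddCommGroup (spaceL d))

instance (d : ℕ) (r : ℂ) : Module ℂ (Lr d r) := inferInstanceAs (Module ℂ (spaceL d))

/-- The commutator `xy - yx` on `𝓛`. -/
def commL {d : ℕ} (x y : spaceL d) : spaceL d :=
  ⟨(x : HeisAlg d) * y - (y : HeisAlg d) * x, spaceL_comm_mem x.2 y.2⟩

/-- `z ↦ π₁(z) + r π₂(z)`. -/
def rescale (d : ℕ) (r : ℂ) : spaceL d →ₗ[ℂ] spaceL d :=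
  pi1 d + (r • pi2 d).smulRight (oneL d)

theorem rescale_eq {d : ℕ} (r : ℂ) (x : spaceL d) :
    rescale d r x = x + ((r - 1) * pi2 d x) • oneL d := by
  have h := pi1_add_pi2 x
  have : rescale d r x = pi1 d x + (r * pi2 d x) • oneL d := rfl
  rw [this]
  nth_rewrite 3 [← h]
  rw [add_assoc, ← add_smul]
  congr 2
  ring

theorem commL_rescale_right {d : ℕ} (r : ℂ) (x y : spaceL d) :
    commL x (rescale d r y) = commL x y := by
  rw [rescale_eq]
  apply Subtype.ext
  change (x : HeisAlg d) * ((y : HeisAlg d) + _ • (1 : HeisAlg d)) -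
    ((y : HeisAlg d) + _ • (1 : HeisAlg d)) * x = (x : HeisAlg d) * y - (y : HeisAlg d) * x
  simp only [mul_add, add_mul, mul_smul_comm, smul_mul_assoc, mul_one, one_mul]
  abel

theorem commL_neg {d : ℕ} (x y : spaceL d) : commL x y = - commL y x :=
  Subtype.ext (neg_sub _ _).symm

theorem commL_rescale_left {d : ℕ} (r : ℂ) (x y : spaceL d) :
    commL (rescale d r x) y = commL x y := by
  rw [commL_neg, commL_rescale_right, ← commL_neg]

theorem commL_self {d : ℕ} (x : spaceL d) : commL x x = 0 := Subtype.ext (sub_self _)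

theorem commL_add {d : ℕ} (x y z : spaceL d) : commL x (y + z) = commL x y + commL x z := by
  apply Subtype.ext
  change (x : HeisAlg d) * ((y : HeisAlg d) + (z : HeisAlg d)) -
    ((y : HeisAlg d) + (z : HeisAlg d)) * (x : HeisAlg d) =
    ((x : HeisAlg d) * y - (y : HeisAlg d) * x) + ((x : HeisAlg d) * z - (z : HeisAlg d) * x)
  noncomm_ring

theorem add_commL {d : ℕ} (x y z : spaceL d) : commL (x + y) z = commL x z + commL y z := by
  rw [commL_neg, commL_add, neg_add, ← commL_neg, ← commL_neg]

theorem commL_smul {d : ℕ} (t : ℂ) (x y : spaceL d) : commL x (t • y) = t • commL x y := by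
  apply Subtype.ext
  change (x : HeisAlg d) * (t • (y : HeisAlg d)) - (t • (y : HeisAlg d)) * (x : HeisAlg d) =
    t • ((x : HeisAlg d) * y - (y : HeisAlg d) * x)
  rw [mul_smul_comm, smul_mul_assoc, smul_sub]

theorem commL_leibniz {d : ℕ} (x y z : spaceL d) :
    commL x (commL y z) = commL (commL x y) z + commL y (commL x z) := by
  apply Subtype.ext
  change (x : HeisAlg d) * ((y : HeisAlg d) * (z : HeisAlg d) - (z : HeisAlg d) * (y : HeisAlg d)) -
      ((y : HeisAlg d) * (z : HeisAlg d) - (z : HeisAlg d) * (y : HeisAlg d)) * (x : HeisAlg d) =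
    (((x : HeisAlg d) * y - (y : HeisAlg d) * x) * (z : HeisAlg d) -
      (z : HeisAlg d) * ((x : HeisAlg d) * y - (y : HeisAlg d) * x)) +
    ((y : HeisAlg d) * ((x : HeisAlg d) * z - (z : HeisAlg d) * x) -
      ((x : HeisAlg d) * z - (z : HeisAlg d) * x) * (y : HeisAlg d))
  noncomm_ring

/-- The identification of `𝓛_r` with `𝓛` as vector spaces. -/
def Lr.toL (d : ℕ) (r : ℂ) : Lr d r ≃ₗ[ℂ] spaceL d := LinearEquiv.refl ℂ (spaceL d)

/-- `[x, y]_r = π₁([x, y]) + r π₂([x, y])`. -/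
instance (d : ℕ) (r : ℂ) : Bracket (Lr d r) (Lr d r) :=
  ⟨fun x y => (Lr.toL d r).symm (rescale d r (commL (Lr.toL d r x) (Lr.toL d r y)))⟩

theorem Lr.toL_lie {d : ℕ} {r : ℂ} (x y : Lr d r) : Lr.toL d r ⁅x, y⁆ =
    rescale d r (commL (Lr.toL d r x) (Lr.toL d r y)) := rfl

instance (d : ℕ) (r : ℂ) : LieRing (Lr d r) where
  add_lie x y z := (Lr.toL d r).injective <| by
    simp only [map_add, Lr.toL_lie, add_commL]
  lie_add x y z := (Lr.toL d r).injective <| by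
    simp only [map_add, Lr.toL_lie, commL_add]
  lie_self x := (Lr.toL d r).injective <| by
    simp only [map_zero, Lr.toL_lie, commL_self]
  leibniz_lie x y z := (Lr.toL d r).injective <| by
    simp only [map_add, Lr.toL_lie, commL_rescale_left, commL_rescale_right]
    rw [commL_leibniz, map_add]

instance (d : ℕ) (r : ℂ) : LieAlgebra ℂ (Lr d r) where
  lie_smul t x y := (Lr.toL d r).injective <| by
    simp only [map_smul, Lr.toL_lie, commL_smul]

/-- The element `v^{ij}(m,n)` of `𝓛_r`. -/
def vij {d : ℕ} (r : ℂ) (i j : Fin d) (m n : ℤ) : Lr d r :=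
  (Lr.toL d r).symm ⟨quad i j m n, quad_mem i j m n⟩

/-! ### The module `M_r` -/

theorem fock_one_of_plus {d : ℕ} {x : HeisAlg d} (hx : x ∈ spaceLPlus d) :
    fock d x 1 = vacExp d x • (1 : MvPolynomial (Fin d × ℤ) ℂ) := by
  rw [spaceLPlus, ← Submodule.span_union] at hx
  induction hx using Submodule.span_induction with
  | zero => simp
  | add a b _ _ ha hb => rw [map_add, map_add, LinearMap.add_apply, ha, hb, add_smul]
  | smul t a _ ha => rw [map_smul, map_smul, LinearMap.smul_apply, ha, smul_assoc]
  | mem a ha =>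
    rcases ha with ha | ha
    · rw [fock_one_of_mem_setBPlus ha, vacExp_of_mem_setB (setBPlus_subset d ha), zero_smul]
    · rw [Set.mem_singleton_iff.mp ha, vacExp_one, map_one (fock d), one_smul, Module.End.one_apply]

theorem vacExp_comm {d : ℕ} {x y : HeisAlg d} (hx : x ∈ spaceLPlus d) (hy : y ∈ spaceLPlus d) :
    vacExp d (x * y - y * x) = 0 := by
  rw [vacExp_apply, map_sub, map_mul, map_mul, LinearMap.sub_apply, Module.End.mul_apply,
    Module.End.mul_apply, fock_one_of_plus hx, fock_one_of_plus hy, map_smul, map_smul,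
    fock_one_of_plus hx, fock_one_of_plus hy, smul_comm, sub_self, map_zero]

/-- The Lie subalgebra `𝓛_r⁺ = Span 𝓑₊ ⊕ ℂ`. -/
def LrPlus (d : ℕ) (r : ℂ) : LieSubalgebra ℂ (Lr d r) :=
  { (spaceLPlus d).comap ((spaceL d).subtype ∘ₗ (Lr.toL d r).toLinearMap) with
    lie_mem' := by
      intro x y hx hy
      change ((Lr.toL d r ⁅x, y⁆ : spaceL d) : HeisAlg d) ∈ spaceLPlus d
      rw [Lr.toL_lie, rescale_eq]
      exact add_mem (spaceLPlus_comm_mem hx hy)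
        (Submodule.smul_mem _ _ (Submodule.mem_sup_right (Submodule.mem_span_singleton_self _))) }

/-- The one-dimensional representation `ℂ𝟏` of `𝓛_r⁺`, on which every `x ∈ 𝓑₊` acts as `0` and
every `s ∈ ℂ` acts as `s`; that is, `x ∈ 𝓛_r⁺` acts as the scalar `π₂(x)`. -/
def vacChar (d : ℕ) (r : ℂ) : LrPlus d r →ₗ⁅ℂ⁆ ℂ :=
  { pi2 d ∘ₗ (Lr.toL d r).toLinearMap ∘ₗ (LrPlus d r).incl.toLinearMap with
    map_lie' := by
      intro x y
      change pi2 d (Lr.toL d r ⁅(x : Lr d r), (y : Lr d r)⁆) =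
        ⁅pi2 d (Lr.toL d r x), pi2 d (Lr.toL d r y)⁆
      rw [LieRing.of_associative_ring_bracket, mul_comm, sub_self, Lr.toL_lie, rescale_eq,
        map_add, map_smul, pi2_eq_vacExp (commL _ _)]
      have h : vacExp d (commL (Lr.toL d r x) (Lr.toL d r y) : HeisAlg d) = 0 :=
        vacExp_comm x.2 y.2
      rw [h, mul_zero, zero_smul, add_zero] }

theorem vacChar_apply {d : ℕ} {r : ℂ} (x : LrPlus d r) :
    vacChar d r x = pi2 d (Lr.toL d r x) := rfl

theorem vacChar_setBPlus {d : ℕ} {r : ℂ} (x : LrPlus d r)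
    (hx : (Lr.toL d r x : HeisAlg d) ∈ setBPlus d) : vacChar d r x = 0 := by
  rw [vacChar_apply, pi2_eq_vacExp, vacExp_of_mem_setB (setBPlus_subset d hx)]

theorem vacChar_scalar {d : ℕ} {r : ℂ} (x : LrPlus d r) (s : ℂ)
    (hx : (Lr.toL d r x : HeisAlg d) = algebraMap ℂ (HeisAlg d) s) : vacChar d r x = s := by
  rw [vacChar_apply, pi2_eq_vacExp, hx, Algebra.algebraMap_eq_smul_one, map_smul, vacExp_one,
    smul_eq_mul, mul_one]

/-- The universal enveloping algebra `U(𝓛_r)`. -/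
abbrev ULr (d : ℕ) (r : ℂ) : Type := UniversalEnvelopingAlgebra ℂ (Lr d r)

/-- The homomorphism `U(𝔥) → U(𝓛_r)` for a Lie subalgebra `𝔥` of `𝓛_r`. -/
def uIncl {d : ℕ} {r : ℂ} (h : LieSubalgebra ℂ (Lr d r)) :
    UniversalEnvelopingAlgebra ℂ h →ₐ[ℂ] ULr d r :=
  UniversalEnvelopingAlgebra.lift ℂ ((UniversalEnvelopingAlgebra.ι ℂ).comp h.incl)

theorem uIncl_ι {d : ℕ} {r : ℂ} (h : LieSubalgebra ℂ (Lr d r)) (x : h) :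
    uIncl h (UniversalEnvelopingAlgebra.ι ℂ x) = UniversalEnvelopingAlgebra.ι ℂ (x : Lr d r) :=
  UniversalEnvelopingAlgebra.lift_ι_apply ℂ _ x

/-- The action of `U(𝓛_r⁺)` on `ℂ𝟏`. -/
def uVacChar (d : ℕ) (r : ℂ) : UniversalEnvelopingAlgebra ℂ (LrPlus d r) →ₐ[ℂ] ℂ :=
  UniversalEnvelopingAlgebra.lift ℂ (vacChar d r)

/-- The relations `u a ⊗ z = u ⊗ a z` for `a ∈ U(𝓛_r⁺)` that turn `U(𝓛_r) ⊗_ℂ ℂ𝟏` into the tensor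
product over `U(𝓛_r⁺)`. -/
def indRel (d : ℕ) (r : ℂ) : Submodule (ULr d r) (ULr d r ⊗[ℂ] ℂ) :=
  Submodule.span (ULr d r) {w | ∃ (u : ULr d r) (a : UniversalEnvelopingAlgebra ℂ (LrPlus d r))
    (z : ℂ), w = (u * uIncl (LrPlus d r) a) ⊗ₜ[ℂ] z - u ⊗ₜ[ℂ] (uVacChar d r a * z)}

/-- The induced module `M_r = U(𝓛_r) ⊗_{U(𝓛_r⁺)} ℂ𝟏`. -/
def Mr (d : ℕ) (r : ℂ) : Type := (ULr d r ⊗[ℂ] ℂ) ⧸ indRel d r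

instance (d : ℕ) (r : ℂ) : AddCommGroup (Mr d r) :=
  inferInstanceAs (AddCommGroup ((ULr d r ⊗[ℂ] ℂ) ⧸ indRel d r))

instance (d : ℕ) (r : ℂ) : Module (ULr d r) (Mr d r) :=
  inferInstanceAs (Module (ULr d r) ((ULr d r ⊗[ℂ] ℂ) ⧸ indRel d r))

instance (d : ℕ) (r : ℂ) : Module ℂ (Mr d r) :=
  inferInstanceAs (Module ℂ ((ULr d r ⊗[ℂ] ℂ) ⧸ indRel d r))

instance (d : ℕ) (r : ℂ) : IsScalarTower ℂ (ULr d r) (Mr d r) :=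
  inferInstanceAs (IsScalarTower ℂ (ULr d r) ((ULr d r ⊗[ℂ] ℂ) ⧸ indRel d r))

/-- The vector `𝟏 ∈ M_r`. -/
def vac (d : ℕ) (r : ℂ) : Mr d r := (indRel d r).mkQ (1 ⊗ₜ[ℂ] (1 : ℂ))

/-- `x ∈ 𝓛_r` acts on `M_r` through `𝓛_r → U(𝓛_r)`. -/
instance (d : ℕ) (r : ℂ) : LieRingModule (Lr d r) (Mr d r) where
  bracket x u := UniversalEnvelopingAlgebra.ι ℂ x • u
  add_lie x y u := by
    change UniversalEnvelopingAlgebra.ι ℂ (x + y) • u = _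
    rw [map_add, add_smul]
  lie_add x u w := smul_add _ _ _
  leibniz_lie x y u := by
    change UniversalEnvelopingAlgebra.ι ℂ x • UniversalEnvelopingAlgebra.ι ℂ y • u =
      UniversalEnvelopingAlgebra.ι ℂ ⁅x, y⁆ • u +
        UniversalEnvelopingAlgebra.ι ℂ y • UniversalEnvelopingAlgebra.ι ℂ x • u
    rw [LieHom.map_lie, LieRing.of_associative_ring_bracket, sub_smul, mul_smul, mul_smul,
      sub_add_cancel]

theorem Mr.lie_def {d : ℕ} {r : ℂ} (x : Lr d r) (u : Mr d r) :
    ⁅x, u⁆ = UniversalEnvelopingAlgebra.ι ℂ x • u := rfl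

instance (d : ℕ) (r : ℂ) : LieModule ℂ (Lr d r) (Mr d r) where
  smul_lie t x u := by
    rw [Mr.lie_def, Mr.lie_def, map_smul, smul_assoc]
  lie_smul t x u := by
    rw [Mr.lie_def, Mr.lie_def, smul_algebra_smul_comm]

/-! ### The subalgebra `𝓛_r^{(1)}` and the module `M_r^{(1)}` -/

/-- `v(m,n) = v^{11}(m,n)`. -/
def v {d : ℕ} [NeZero d] (r : ℂ) (m n : ℤ) : Lr d r := vij r 0 0 m n

/-- The Lie subalgebra `𝓛_r^{(1)}` of `𝓛_r` generated by the `v(m,n)` with `m ≤ n`. -/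
def Lr1 (d : ℕ) [NeZero d] (r : ℂ) : LieSubalgebra ℂ (Lr d r) :=
  LieSubalgebra.lieSpan ℂ (Lr d r) {x | ∃ m n : ℤ, m ≤ n ∧ x = v r m n}

/-- The `𝓛_r^{(1)}`-submodule `M_r^{(1)} = U(𝓛_r^{(1)}) 𝟏` of `M_r`. -/
def Mr1 (d : ℕ) [NeZero d] (r : ℂ) : LieSubmodule ℂ (Lr1 d r) (Mr d r) where
  carrier := {u | ∃ a : UniversalEnvelopingAlgebra ℂ (Lr1 d r), u = uIncl (Lr1 d r) a • vac d r}
  zero_mem' := ⟨0, by rw [map_zero, zero_smul]⟩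
  add_mem' := by
    rintro _ _ ⟨a, rfl⟩ ⟨b, rfl⟩
    exact ⟨a + b, by rw [map_add, add_smul]⟩
  smul_mem' := by
    rintro t _ ⟨a, rfl⟩
    exact ⟨t • a, by rw [map_smul, smul_assoc]⟩
  lie_mem := by
    rintro x _ ⟨a, rfl⟩
    refine ⟨UniversalEnvelopingAlgebra.ι ℂ x * a, ?_⟩
    rw [map_mul, mul_smul]
    have h : uIncl (Lr1 d r) (UniversalEnvelopingAlgebra.ι ℂ x) =
        UniversalEnvelopingAlgebra.ι ℂ (x : Lr d r) := uIncl_ι _ x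
    rw [h]
    rfl

/-- `h_{k,l} = -(1/l) v^{kk}(l,-l)` for `l < 0`; these form a basis of the subspace `𝓗` of
`𝓛_r`, so that a linear form on `𝓗` is the same as the family of its values on the `h_{k,l}`. -/
def hkl {d : ℕ} (r : ℂ) (k : Fin d) (l : ℤ) : Lr d r := (-(1 / (l : ℂ))) • vij r k k l (-l)

/-- `u` has weight `∑_{l < 0} a_l Λ_{1,l}`, where `(Λ_{k,l})` is the dual family of
`(h_{k,l})`. -/
def HasWeight1 {d : ℕ} [NeZero d] {r : ℂ} (a : {l : ℤ // l < 0} →₀ ℕ) (u : Mr d r) : Prop :=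
  ∀ (k : Fin d) (l : {l : ℤ // l < 0}),
    ⁅hkl r k l, u⁆ = (if k = 0 then (a l : ℂ) else 0) • u

/-- A singular vector of `M_r^{(1)}`: a nonzero element of `M_r^{(1)}`, homogeneous of a nonzero
weight in `Q₊^{(1)} = ∑_{l < 0} ℤ_{≥ 0} Λ_{1,l}`, that is killed by all `v(m,n)` with
`m + n > 0`. -/
def IsSingular {d : ℕ} [NeZero d] {r : ℂ} (u : Mr d r) : Prop :=
  u ∈ Mr1 d r ∧ u ≠ 0 ∧ (∃ a : {l : ℤ // l < 0} →₀ ℕ, a ≠ 0 ∧ HasWeight1 a u) ∧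
    ∀ m n : ℤ, 0 < m + n → ⁅v (d := d) r m n, u⁆ = 0

/-- The determinant `∑_σ sgn(σ) ∏_{q=1}^p v(-q,-σ(q))` in `U(𝓛_r)` of the matrix
`(v(-s,-t))_{1 ≤ s,t ≤ p}`, whose entries commute with each other. Indices run from `0` to `p - 1`,
and the products are taken in the order of increasing `q`. -/
def detV (d : ℕ) [NeZero d] (r : ℂ) (p : ℕ) : ULr d r :=
  ∑ σ : Equiv.Perm (Fin p), ((Equiv.Perm.sign σ : ℤ) : ℂ) •
    (List.ofFn fun q : Fin p =>
      UniversalEnvelopingAlgebra.ι ℂ (v (d := d) r (-((q : ℤ) + 1)) (-((σ q : ℤ) + 1)))).prod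

end

end JordanVOA

open scoped TensorProduct

namespace JordanVOA

noncomputable section

attribute [local instance 100] LieRing.ofAssociativeRing

/-! ### Derivations and determinants -/

/-! Write `f` for the determinant and `e` for the vacuum `𝟏`. The operators `v(-s,-t)` commute, so
polynomials in the entries of a generic matrix act on `e`. On such vectors `v(-t,k)` acts by the
derivation that replaces row `k` by row `t` and column `k` by column `t`, times `k`. Hence it kills
`f ^ ν` for `t ≠ k` and has it as an eigenvector for `t = k`, which also gives the weight. The
operator `v(k,k)` acts by a second order operator. Two commutators with `f` suffice to compute it,
and the result is `v(k,k) f ^ ν e = 2 k² ν (r - p + 2 ν - 1) f ^ (ν - 1) C e`, where `C` is the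
cofactor of the entry `(k,k)`; the linear factor is zero exactly when `r = 1 - 2 ν + p`. This is
`annihilate_det_pow`. For `0 < m < n ≤ p` the operator `v(m,n)` is a multiple of a commutator of
`v(-n,m)` and `v(n,n)`. Modes beyond `p` and the mode `0` have no contraction with the modes in `f`,
so `v(m,n)` with `n > p`, or with `m = 0 < n`, kills every polynomial in the lowering operators
applied to `e` (`opV_kill_det_pow`).

That `f ^ ν e ≠ 0` holds for all `r`, and it is proved without a basis of `M_r`. The algebra `𝓛_r`
acts from the right by first order operators on polynomials in a symmetric matrix `Z` of positive
modes, hence from the left on functionals. The constant-coefficient functional satisfies the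
relations of the vacuum, so `M_r` maps to functionals (`exists_toDual`). There `v(-s,-t)` is the
transpose of a constant-coefficient derivation. On divided powers of the trace of `Z` the matrix
`V_p` acts like an invertible diagonal matrix, so `f ^ ν e` takes a nonzero value on one of them
(`detV_pow_vac_ne_zero`).

For reducibility, the submodule generated by `f ^ ν e` is already obtained with the `v(m,n)`, `m + n
≤ 0` (`opV_mem_lowerClosure`). These preserve the functionals that vanish at the polynomial `1`. The
image of `f ^ ν e` vanishes there and that of `e` does not, so the submodule is nonzero and proper.
-/

theorem derivation_prod {κ R S : Type*} [DecidableEq κ] [CommRing R] [CommRing S] [Algebra R S]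
    (D : Derivation R S S) (s : Finset κ) (f : κ → S) :
    D (∏ i ∈ s, f i) = ∑ j ∈ s, (∏ i ∈ s.erase j, f i) * D (f j) := by
  induction s using Finset.induction_on with
  | empty => simp
  | insert a s ha ih =>
    rw [Finset.prod_insert ha, D.leibniz, ih, Finset.sum_insert ha, Finset.erase_insert ha,
      smul_eq_mul, smul_eq_mul, Finset.mul_sum, add_comm]
    congr 1
    refine Finset.sum_congr rfl fun j hj => ?_
    have haj : a ≠ j := fun h => ha (h ▸ hj)
    rw [Finset.erase_insert_of_ne haj, Finset.prod_insert (fun h => ha (Finset.mem_of_mem_erase h)),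
      mul_assoc]

theorem derivation_det_col {ι R S : Type*} [Fintype ι] [DecidableEq ι] [CommRing R] [CommRing S]
    [Algebra R S] (D : Derivation R S S) (M : Matrix ι ι S) :
    D M.det = ∑ j, (M.updateCol j fun i => D (M i j)).det := by
  simp only [Matrix.det_apply]
  rw [map_sum, Finset.sum_comm]
  refine Finset.sum_congr rfl fun σ _ => ?_
  rw [← Finset.smul_sum, Units.smul_def, Units.smul_def, map_zsmul, derivation_prod]
  congr 1
  refine Finset.sum_congr rfl fun j _ => ?_
  rw [← Finset.prod_erase_mul _ _ (Finset.mem_univ j), Matrix.updateCol_self]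
  congr 1
  exact Finset.prod_congr rfl fun i hi => by rw [Matrix.updateCol_ne (Finset.ne_of_mem_erase hi)]

theorem derivation_det {ι R S : Type*} [Fintype ι] [DecidableEq ι] [CommRing R] [CommRing S]
    [Algebra R S] (D : Derivation R S S) (M : Matrix ι ι S) :
    D M.det = ∑ i, (M.updateRow i fun j => D (M i j)).det := by
  rw [← Matrix.det_transpose, derivation_det_col]
  refine Finset.sum_congr rfl fun i _ => ?_
  rw [Matrix.updateCol_transpose, Matrix.det_transpose]
  rfl

theorem adjugate_apply_updateCol {ι S : Type*} [Fintype ι] [DecidableEq ι] [CommRing S]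
    (M : Matrix ι ι S) (i j : ι) :
    M.adjugate i j = (M.updateCol i (Pi.single j 1)).det := by
  rw [← Matrix.transpose_apply M.adjugate, Matrix.adjugate_transpose, Matrix.adjugate_apply,
    Matrix.updateRow_transpose, Matrix.det_transpose]

theorem det_mem {ι S : Type*} [Fintype ι] [DecidableEq ι] [CommRing S] [Algebra ℂ S]
    (T : Subalgebra ℂ S) (M : Matrix ι ι S) (h : ∀ i j, M i j ∈ T) : M.det ∈ T := by
  rw [Matrix.det_apply]
  refine sum_mem fun σ _ => ?_
  rw [Units.smul_def]
  exact zsmul_mem (prod_mem fun i _ => h _ _) _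

open scoped IsMulCommutative in
/-- Evaluation of polynomials at pairwise commuting elements. -/
theorem exists_aeval_of_commute {κ A : Type*} [Ring A] [Algebra ℂ A] (x : κ → A)
    (hx : ∀ i j, x i * x j = x j * x i) :
    ∃ φ : MvPolynomial κ ℂ →ₐ[ℂ] A, ∀ i, φ (MvPolynomial.X i) = x i := by
  have hc : ∀ a ∈ Set.range x, ∀ b ∈ Set.range x, a * b = b * a := by
    rintro _ ⟨i, rfl⟩ _ ⟨j, rfl⟩
    exact hx i j
  have := Algebra.isMulCommutative_adjoin ℂ hc
  refine ⟨(Algebra.adjoin ℂ (Set.range x)).val.comp (MvPolynomial.aeval fun i =>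
    (⟨x i, Algebra.subset_adjoin ⟨i, rfl⟩⟩ : Algebra.adjoin ℂ (Set.range x))), fun i => ?_⟩
  simp

/-- The matrix of variables. -/
def genMat (ι : Type*) : Matrix ι ι (MvPolynomial (ι × ι) ℂ) :=
  Matrix.of fun i j => MvPolynomial.X (i, j)

theorem genMat_apply {ι : Type*} (i j : ι) : genMat ι i j = MvPolynomial.X (i, j) := rfl

/-! ### Polarization derivations on the determinant and cofactors of a generic matrix. -/

section Generic

variable {ι : Type*} [DecidableEq ι]

/-- The derivation which replaces the row `k` by the row `t`, plus the one which replaces the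
column `k` by the column `t`, times `z`. -/
def replaceDer (z : ℂ) (k t : ι) :
    Derivation ℂ (MvPolynomial (ι × ι) ℂ) (MvPolynomial (ι × ι) ℂ) :=
  MvPolynomial.mkDerivation ℂ fun a =>
    z • ((if a.1 = k then MvPolynomial.X (t, a.2) else 0) +
      (if a.2 = k then MvPolynomial.X (a.1, t) else 0))

theorem replaceDer_genMat (z : ℂ) (k t i j : ι) : replaceDer z k t (genMat ι i j) =
    z • ((if i = k then genMat ι t j else 0) + (if j = k then genMat ι i t else 0)) := by
  rw [genMat_apply, replaceDer, MvPolynomial.mkDerivation_X]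
  rfl

section Det

variable [Fintype ι]

theorem det_updateRow_row {S : Type*} [CommRing S] (M : Matrix ι ι S) (k t : ι) :
    (M.updateRow k (M t)).det = if t = k then M.det else 0 := by
  split_ifs with h
  · rw [h, Matrix.updateRow_eq_self]
  · exact Matrix.det_updateRow_eq_zero h

theorem sum_mul_adjugate {S : Type*} [CommRing S] (M : Matrix ι ι S) (k t : ι) :
    ∑ i, M i t * M.adjugate k i = if t = k then M.det else 0 := by
  have h := congrFun (congrFun (Matrix.adjugate_mul M) k) t
  rw [Matrix.mul_apply, Matrix.smul_apply, Matrix.one_apply] at h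
  simp only [mul_comm (M _ t)]
  rw [h]
  by_cases hk : t = k
  · rw [if_pos hk, if_pos hk.symm, smul_eq_mul, mul_one]
  · rw [if_neg hk, if_neg (Ne.symm hk), smul_zero]

/-- Expanding along rows, the row replacement contributes the determinant with row `t` in place of
row `k`, and the column replacement adds up to the determinant with column `t` in place of column
`k`. Both have a repeated line unless `t = k`. -/
theorem replaceDer_det (z : ℂ) (k t : ι) : replaceDer z k t (genMat ι).det =
    if t = k then (2 * z) • (genMat ι).det else 0 := by
  have e : ∀ i, ((genMat ι).updateRow i fun j => replaceDer z k t (genMat ι i j)).det =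
      z • ((if i = k then ((genMat ι).updateRow k (genMat ι t)).det else 0) +
        genMat ι i t * (genMat ι).adjugate k i) := by
    intro i
    have : (fun j => replaceDer z k t (genMat ι i j)) =
        z • ((if i = k then genMat ι t else 0) +
          genMat ι i t • (Pi.single k 1 : ι → MvPolynomial (ι × ι) ℂ)) := by
      funext j
      rw [replaceDer_genMat]
      by_cases hi : i = k <;> by_cases hj : j = k <;> simp [hi, hj]
    have hz : ∀ w : ι → MvPolynomial (ι × ι) ℂ,
        z • w = (MvPolynomial.C z : MvPolynomial (ι × ι) ℂ) • w := by
      intro w; funext j; simp [MvPolynomial.smul_eq_C_mul]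
    rw [this, hz, Matrix.det_updateRow_smul, Matrix.det_updateRow_add, Matrix.det_updateRow_smul,
      ← Matrix.adjugate_apply, MvPolynomial.smul_eq_C_mul]
    congr 2
    split_ifs with hi
    · rw [hi]
    · exact Matrix.det_eq_zero_of_row_eq_zero i fun j => by rw [Matrix.updateRow_self]; rfl
  rw [derivation_det, Finset.sum_congr rfl fun i _ => e i, ← Finset.smul_sum,
    Finset.sum_add_distrib, sum_mul_adjugate, Finset.sum_ite_eq' Finset.univ k,
    if_pos (Finset.mem_univ k), det_updateRow_row]
  split_ifs
  · rw [← two_smul ℂ, smul_smul, mul_comm]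
  · simp

/-- The cofactor is the determinant of `N`, whose row `k` is the constant `e_t`, so only the column
replacement in the other rows acts. Adding and subtracting the term of row `k` completes a column
expansion of `N`, which vanishes for `t ≠ k`; the subtracted term is the cofactor of `(k,k)`. -/
theorem replaceDer_adjugate (z : ℂ) (k t : ι) :
    replaceDer z k t ((genMat ι).adjugate t k) =
      if t = k then 0 else -(z • (genMat ι).adjugate k k) := by
  set N := (genMat ι).updateRow k (Pi.single t 1) with hN
  have e : ∀ i, (N.updateRow i fun j => replaceDer z k t (N i j)).det =
      z • (N i t * N.adjugate k i - if i = k then (genMat ι).adjugate k k else 0) := by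
    intro i
    by_cases hi : i = k
    · subst hi
      have h0 : (fun j => replaceDer z i t (N i j)) = 0 := by
        funext j
        rw [hN, Matrix.updateRow_self]
        by_cases hj : j = t <;> simp [hj]
      rw [h0, Matrix.det_eq_zero_of_row_eq_zero i fun j => by rw [Matrix.updateRow_self]; rfl,
        if_pos rfl, Matrix.adjugate_apply N, hN, Matrix.updateRow_idem, ← Matrix.adjugate_apply,
        Matrix.updateRow_self]
      simp
    · have : (fun j => replaceDer z k t (N i j)) =
          (MvPolynomial.C z * N i t) • (Pi.single k 1 : ι → MvPolynomial (ι × ι) ℂ) := by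
        funext j
        rw [hN, Matrix.updateRow_ne hi, replaceDer_genMat]
        by_cases hj : j = k <;> simp [hi, hj, MvPolynomial.smul_eq_C_mul]
      rw [this, Matrix.det_updateRow_smul, ← Matrix.adjugate_apply, if_neg hi, sub_zero,
        MvPolynomial.smul_eq_C_mul, mul_assoc]
  rw [Matrix.adjugate_apply, ← hN, derivation_det, Finset.sum_congr rfl fun i _ => e i,
    ← Finset.smul_sum, Finset.sum_sub_distrib, sum_mul_adjugate, Finset.sum_ite_eq' Finset.univ k,
    if_pos (Finset.mem_univ k)]
  split_ifs with h
  · rw [hN, h, ← Matrix.adjugate_apply, sub_self, smul_zero]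
  · rw [zero_sub, smul_neg]

end Det

/-! ### Second order operators on powers of the determinant. -/

section Action

variable {A M : Type*} [Ring A] [Algebra ℂ A] [AddCommGroup M] [Module A M] [Module ℂ M]
  [IsScalarTower ℂ A M]

/-- The commutator with `y` satisfies the Leibniz rule, so it is determined by the variables. `φ`
need not be injective, which allows the generic matrix to be mapped to a symmetric one. -/
theorem replaceDer_spec (φ : MvPolynomial (ι × ι) ℂ →ₐ[ℂ] A) (z : ℂ) (k t : ι) (y : A)
    (hy : ∀ i j, y * φ (genMat ι i j) =
      φ (genMat ι i j) * y + φ (replaceDer z k t (genMat ι i j)))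
    (s : MvPolynomial (ι × ι) ℂ) : y * φ s = φ s * y + φ (replaceDer z k t s) := by
  induction s using MvPolynomial.induction_on with
  | C a =>
    rw [← MvPolynomial.algebraMap_eq, AlgHom.commutes, Derivation.map_algebraMap, map_zero,
      add_zero, Algebra.commutes]
  | add f g hf hg => rw [map_add, map_add, map_add, mul_add, add_mul, hf, hg]; abel
  | mul_X f a hf =>
    have ha := hy a.1 a.2
    rw [genMat_apply] at ha
    rw [map_mul, ← mul_assoc, hf, add_mul, mul_assoc, ha, Derivation.leibniz, map_add,
      smul_eq_mul, smul_eq_mul, map_mul, map_mul, mul_add, mul_assoc, ← map_mul, ← map_mul,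
      ← map_mul, mul_comm (MvPolynomial.X a) (replaceDer z k t f), add_assoc]

/-- Powers of an element behave under a commutator as under a second order differential
operator, provided that the iterated commutator `[[x, b], b]` commutes with `b`. -/
theorem mul_pow_of_comm {A : Type*} [Ring A] {x b c d : A}
    (h1 : x * b = b * x + c) (h2 : c * b = b * c + d)
    (h3 : d * b = b * d) (n : ℕ) :
    x * b ^ n = b ^ n * x + n • (b ^ (n - 1) * c) + n.choose 2 • (b ^ (n - 2) * d) := by
  have hc : ∀ n : ℕ, c * b ^ n = b ^ n * c + n • (b ^ (n - 1) * d) := by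
    intro n
    induction n with
    | zero => simp
    | succ n ih =>
      rw [pow_succ, ← mul_assoc, ih, add_mul, mul_assoc, h2, mul_add, smul_mul_assoc, mul_assoc, h3,
        ← mul_assoc, ← mul_assoc, ← pow_succ, Nat.add_sub_cancel, succ_nsmul]
      -- The exponent `n - 1` is truncated at `n = 0`, where its coefficient is zero.
      rcases n with _ | n
      · simp
      · rw [Nat.add_sub_cancel, ← pow_succ]; abel
  induction n with
  | zero => simp
  | succ n ih =>
    rw [pow_succ, ← mul_assoc, ih, Nat.choose_succ_succ' n 1, Nat.choose_one_right,
      Nat.add_sub_cancel, add_mul, add_mul, mul_assoc, h1, mul_add,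
      smul_mul_assoc, smul_mul_assoc, mul_assoc, mul_assoc, h2, h3, mul_add, smul_add,
      ← mul_assoc, ← mul_assoc, ← mul_assoc, ← pow_succ, add_smul n (n.choose 2), succ_nsmul,
      show n + 1 - 2 = n - 1 by omega]
    rcases n with _ | _ | n
    · simp
    · simp
      abel
    · rw [show n + 1 + 1 - 1 = n + 1 by omega, show n + 1 + 1 - 2 = n by omega, ← pow_succ,
        ← pow_succ]
      abel

/-- The operator `E` acts on powers of the determinant by a second order differential operator
that annihilates the power whose exponent is the root of a linear polynomial. -/
theorem annihilate_det_pow [Fintype ι] (φ : MvPolynomial (ι × ι) ℂ →ₐ[ℂ] A) (z r : ℂ) (k : ι)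
    (y : ι → A) (E : A) (e : M)
    (hy : ∀ t i j, y t * φ (genMat ι i j) =
      φ (genMat ι i j) * y t + φ (replaceDer z k t (genMat ι i j)))
    (hE : ∀ i j, i ≠ k → j ≠ k → E * φ (genMat ι i j) = φ (genMat ι i j) * E)
    (hEc : ∀ i, i ≠ k → E * φ (genMat ι i k) = φ (genMat ι i k) * E + (2 * z) • y i)
    (hEr : ∀ j, E * φ (genMat ι k j) = φ (genMat ι k j) * E +
      (2 * z) • (y j + if j = k then y k + algebraMap ℂ A (z * r) else 0))
    (hye : ∀ t, y t • e = 0) (hEe : E • e = 0) (n : ℕ) (hn : 1 ≤ n)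
    (hr : r - Fintype.card ι + 2 * n - 1 = 0) :
    E • (φ (genMat ι).det) ^ n • e = 0 := by
  have hys := fun t => replaceDer_spec φ z k t (y t) (hy t)
  -- elements that do not involve the index `k`
  let T : Subalgebra ℂ (MvPolynomial (ι × ι) ℂ) :=
    (Subalgebra.centralizer ℂ (insert E (Set.range y))).comap φ
  have hT : ∀ i j, i ≠ k → j ≠ k → genMat ι i j ∈ T := by
    intro i j hi hj
    change φ (genMat ι i j) ∈ Subalgebra.centralizer ℂ (insert E (Set.range y))
    rw [Subalgebra.mem_centralizer_iff]
    rintro _ (rfl | ⟨t, rfl⟩)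
    · exact hE i j hi hj
    · rw [hy, replaceDer_genMat, if_neg hi, if_neg hj, add_zero, smul_zero, map_zero, add_zero]
  have hTE : ∀ s ∈ T, E * φ s = φ s * E := fun s hs =>
    (Subalgebra.mem_centralizer_iff ℂ).mp hs E (Set.mem_insert _ _)
  have hTy : ∀ s ∈ T, ∀ t, y t * φ s = φ s * y t := fun s hs t =>
    (Subalgebra.mem_centralizer_iff ℂ).mp hs (y t) (Set.mem_insert_of_mem _ ⟨t, rfl⟩)
  set f := (genMat ι).det with hf
  -- `C j` is the cofactor of the entry `(k,j)`, that is, the determinant of `N j`. Expanding `N j`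
  -- along column `k` gives the coefficients `c j i`, which involve neither row `k` nor column `k`
  -- of the generic matrix. Thus the determinant is split into an entry of row `k`, an entry of
  -- column `k`, and factors that commute with `E` and all `y t`.
  let N : ι → Matrix ι ι (MvPolynomial (ι × ι) ℂ) := fun j =>
    (genMat ι).updateRow k (Pi.single j 1)
  let C : ι → MvPolynomial (ι × ι) ℂ := fun j => (genMat ι).adjugate j k
  let c : ι → ι → MvPolynomial (ι × ι) ℂ := fun j i => (N j).adjugate k i
  have hcT : ∀ j i, c j i ∈ T := by
    intro j i
    change (N j).adjugate k i ∈ T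
    rw [adjugate_apply_updateCol]
    refine det_mem T _ fun a b => ?_
    have h01 : ∀ a b : ι, (Pi.single a 1 : ι → MvPolynomial (ι × ι) ℂ) b ∈ T := by
      intro a b
      rw [Pi.single_apply]
      split_ifs
      exacts [one_mem _, zero_mem _]
    by_cases hb : b = k
    · rw [hb, Matrix.updateCol_self]; exact h01 _ _
    · rw [Matrix.updateCol_ne hb]
      by_cases ha : a = k
      · have : N j a b = (Pi.single j 1 : ι → MvPolynomial (ι × ι) ℂ) b := by
          change (genMat ι).updateRow k (Pi.single j 1) a b = _
          rw [ha, Matrix.updateRow_self]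
        rw [this]
        exact h01 _ _
      · have : N j a b = genMat ι a b := by
          change (genMat ι).updateRow k (Pi.single j 1) a b = _
          rw [Matrix.updateRow_ne ha]
        rw [this]
        exact hT a b ha hb
  have hC : ∀ j, C j = ∑ i, N j i k * c j i := by
    intro j
    change (genMat ι).adjugate j k = _
    rw [Matrix.adjugate_apply, Matrix.det_eq_sum_mul_adjugate_col _ k]
  have hfC : f = ∑ j, genMat ι k j * C j := Matrix.det_eq_sum_mul_adjugate_row _ k
  -- the commutator of `E` with the cofactors
  let Q : ι → A := fun j => ∑ i, if i = k then 0 else (2 * z) • (φ (c j i) * y i)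
  have hEC : ∀ j, E * φ (C j) = φ (C j) * E + Q j := by
    intro j
    rw [hC, map_sum, Finset.mul_sum, Finset.sum_mul, ← Finset.sum_add_distrib]
    refine Finset.sum_congr rfl fun i _ => ?_
    rw [map_mul, ← mul_assoc]
    by_cases hi : i = k
    · have : N j i k ∈ T := by
        rw [hi]
        change (genMat ι).updateRow k (Pi.single j 1) k k ∈ T
        rw [Matrix.updateRow_self, Pi.single_apply]
        split_ifs
        exacts [one_mem _, zero_mem _]
      rw [if_pos hi, add_zero, hTE _ this, mul_assoc, hTE _ (hcT j i), mul_assoc]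
    · have : N j i k = genMat ι i k := by
        change (genMat ι).updateRow k (Pi.single j 1) i k = _
        rw [Matrix.updateRow_ne hi]
      rw [if_neg hi, this, hEc i hi, add_mul, mul_assoc, hTE _ (hcT j i), smul_mul_assoc,
        hTy _ (hcT j i), mul_assoc]
  have hQe : ∀ j, Q j • e = 0 := by
    intro j
    change (∑ i, if i = k then 0 else (2 * z) • (φ (c j i) * y i)) • e = 0
    rw [Finset.sum_smul]
    refine Finset.sum_eq_zero fun i _ => ?_
    split_ifs
    · rw [zero_smul]
    · rw [← smul_mul_assoc, mul_smul, hye, smul_zero]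
  have hyf : ∀ t, y t * φ f = φ f * y t + if t = k then (2 * z) • φ f else 0 := by
    intro t
    rw [hys, replaceDer_det]
    split_ifs
    · rw [map_smul]
    · rw [map_zero]
  -- `Q j` only involves the `y i` with `i ≠ k`, and these commute with the determinant.
  have hQf : ∀ j, Q j * φ f = φ f * Q j := by
    intro j
    change (∑ i, if i = k then 0 else (2 * z) • (φ (c j i) * y i)) * _ = _ * ∑ i, _
    rw [Finset.sum_mul, Finset.mul_sum]
    refine Finset.sum_congr rfl fun i _ => ?_
    split_ifs with hi
    · rw [zero_mul, mul_zero]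
    · rw [smul_mul_assoc, mul_smul_comm, mul_assoc, hyf, if_neg hi, add_zero, ← mul_assoc,
        ← mul_assoc, ← map_mul, ← map_mul, mul_comm f]
  -- the commutator of `E` with the determinant
  let W : ι → A := fun j => (2 * z) • (y j + if j = k then y k + algebraMap ℂ A (z * r) else 0)
  let B : A := ∑ j, (W j * φ (C j) + φ (genMat ι k j) * Q j)
  have hEf : E * φ f = φ f * E + B := by
    change _ = _ + ∑ j, (W j * φ (C j) + φ (genMat ι k j) * Q j)
    rw [hfC, map_sum, Finset.mul_sum, Finset.sum_mul, ← Finset.sum_add_distrib]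
    refine Finset.sum_congr rfl fun j _ => ?_
    rw [map_mul, ← mul_assoc, hEr, add_mul, mul_assoc, hEC, mul_add, mul_assoc]
    abel
  -- `W k` contains `2 z · 2 y k`, and commuting `y k` past the determinant produces `2 z` times it;
  -- hence `8 z ^ 2`.
  have hWf : ∀ j, W j * φ f = φ f * W j + if j = k then (8 * z ^ 2) • φ f else 0 := by
    intro j
    change ((2 * z) • (y j + if j = k then _ else 0)) * _ = _ * ((2 * z) • (y j + _)) + _
    rw [smul_mul_assoc, mul_smul_comm, add_mul, mul_add, hyf]
    by_cases hj : j = k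
    · rw [if_pos hj, if_pos hj, if_pos hj, add_mul, hyf, if_pos rfl, Algebra.commutes,
        mul_add, hj, show 8 * z ^ 2 = 2 * z * (2 * z + 2 * z) by ring, mul_smul (2 * z),
        ← smul_add, add_smul (2 * z) (2 * z)]
      congr 1
      abel
    · simp only [if_neg hj, zero_mul, mul_zero, add_zero]
  have hBf : B * φ f = φ f * B + (8 * z ^ 2) • φ (f * C k) := by
    have : ∀ j, (W j * φ (C j) + φ (genMat ι k j) * Q j) * φ f =
        φ f * (W j * φ (C j) + φ (genMat ι k j) * Q j) +
          if j = k then (8 * z ^ 2) • φ (f * C k) else 0 := by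
      intro j
      rw [add_mul, mul_assoc, mul_assoc, hQf, ← map_mul, mul_comm (C j), map_mul, ← mul_assoc, hWf,
        add_mul, ← mul_assoc, ← map_mul, mul_comm (genMat ι k j), map_mul]
      by_cases hj : j = k
      · rw [if_pos hj, if_pos hj, hj, smul_mul_assoc, map_mul]
        simp only [mul_add, mul_assoc]
        abel
      · rw [if_neg hj, if_neg hj, zero_mul]
        simp only [mul_add, mul_assoc]
        abel
    change (∑ j, _) * _ = _ * (∑ j, _) + _
    rw [Finset.sum_mul, Finset.sum_congr rfl fun j _ => this j, Finset.sum_add_distrib,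
      Finset.mul_sum, Finset.sum_ite_eq' Finset.univ k, if_pos (Finset.mem_univ k)]
  -- Each of the `card ι - 1` indices `j ≠ k` contributes `2 z · (-z)` through the derivative of the
  -- cofactor `C j`. The index `k` contributes `2 z · z r` through the scalar in `W k`, the only
  -- place where `r` enters.
  have hBe : B • e = (2 * z ^ 2 * (r - Fintype.card ι + 1)) • φ (C k) • e := by
    have hyC : ∀ j, y j • φ (C j) • e = if j = k then 0 else -(z • φ (C k) • e) := by
      intro j
      rw [← mul_smul, hys, add_smul, mul_smul, hye, smul_zero, zero_add]
      change φ (replaceDer z k j ((genMat ι).adjugate j k)) • e = _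
      rw [replaceDer_adjugate]
      split_ifs
      · rw [map_zero, zero_smul]
      · rw [map_neg, map_smul, neg_smul, smul_assoc]
    have hterm : ∀ j, (W j * φ (C j) + φ (genMat ι k j) * Q j) • e =
        (2 * z ^ 2 * ((if j = k then r + 1 else 0) - 1)) • φ (C k) • e := by
      intro j
      change ((2 * z) • (y j + if j = k then _ else 0) * φ (C j) + _) • e = _
      rw [add_smul, mul_smul _ (Q j), hQe, smul_zero, add_zero, mul_smul, smul_assoc, add_smul, hyC]
      by_cases hj : j = k
      · have := hyC k
        rw [if_pos rfl] at this
        rw [if_pos hj, if_pos hj, if_pos hj, hj, add_smul, this, algebraMap_smul, zero_add,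
          zero_add, smul_smul]
        congr 1
        ring
      · rw [if_neg hj, if_neg hj, if_neg hj, zero_smul, add_zero, smul_neg, smul_smul, ← neg_smul]
        congr 1
        ring
    change (∑ j, (W j * φ (C j) + φ (genMat ι k j) * Q j)) • e = _
    rw [Finset.sum_smul, Finset.sum_congr rfl fun j _ => hterm j, ← Finset.sum_smul,
      ← Finset.mul_sum, Finset.sum_sub_distrib, Finset.sum_ite_eq' Finset.univ k,
      if_pos (Finset.mem_univ k), Finset.sum_const, Finset.card_univ, nsmul_one]
    congr 2
    ring
  have hdf : (8 * z ^ 2) • φ (f * C k) * φ f = φ f * (8 * z ^ 2) • φ (f * C k) := by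
    rw [smul_mul_assoc, mul_smul_comm, ← map_mul, ← map_mul, mul_comm f (f * C k)]
  obtain ⟨m, rfl⟩ := Nat.exists_eq_add_of_le' hn
  -- For `m = 0` the exponent `m + 1 - 2` is truncated, but the binomial coefficient is zero.
  have hlast : ((m + 1).choose 2 • (φ f ^ (m + 1 - 2) * (8 * z ^ 2) • φ (f * C k))) • e =
      (((m + 1).choose 2 : ℂ) * (8 * z ^ 2)) • φ f ^ m • φ (C k) • e := by
    rcases m with _ | m
    · simp
    · rw [show m + 1 + 1 - 2 = m by omega, map_mul, mul_smul_comm, ← mul_assoc, ← pow_succ,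
        ← Nat.cast_smul_eq_nsmul ℂ, smul_smul, smul_assoc, mul_smul (φ f ^ _)]
  rw [← mul_smul, mul_pow_of_comm hEf hBf hdf, add_smul, add_smul, mul_smul, hEe, smul_zero,
    zero_add, hlast, Nat.add_sub_cancel, ← Nat.cast_smul_eq_nsmul ℂ, smul_assoc, mul_smul (φ f ^ m),
    hBe, smul_algebra_smul_comm, smul_smul, ← add_smul, Nat.cast_choose_two]
  have : ((m + 1 : ℕ) : ℂ) * (2 * z ^ 2 * (r - Fintype.card ι + 1)) +
      ((m + 1 : ℕ) : ℂ) * (((m + 1 : ℕ) : ℂ) - 1) / 2 * (8 * z ^ 2) =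
      2 * z ^ 2 * ((m + 1 : ℕ) : ℂ) * (r - Fintype.card ι + 2 * ((m + 1 : ℕ) : ℂ) - 1) := by
    ring
  rw [this, hr, mul_zero, zero_smul]

end Action

end Generic

/-! ### Linear maps on `𝓛_r` given by their values on the quadratic elements -/

/-- Elements of an algebra which satisfy the commutation relations of the `v^i(m)` define a
representation of the quotient algebra. -/
theorem exists_heisAlg_lift {d : ℕ} {B : Type*} [Ring B] [Algebra ℂ B] (F : Fin d × ℤ → B)
    (hF : ∀ a b, F a * F b - F b * F a =
      heisForm d (Finsupp.single a 1) (Finsupp.single b 1) • (1 : B)) :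
    ∃ ψ : HeisAlg d →ₐ[ℂ] B, ∀ i m, ψ (gen i m) = F (i, m) := by
  let lin : (Fin d × ℤ →₀ ℂ) →ₗ[ℂ] B := Finsupp.lsum ℂ fun a => LinearMap.toSpanSingleton ℂ _ (F a)
  have hlin : ∀ a z, lin (Finsupp.single a z) = z • F a := fun a z => by simp [lin]
  have hcomm : ∀ f g, lin f * lin g - lin g * lin f = heisForm d f g • (1 : B) := by
    have : (LinearMap.mul ℂ B).compl₁₂ lin lin - ((LinearMap.mul ℂ B).compl₁₂ lin lin).flip =
        (heisForm d).compr₂ (LinearMap.toSpanSingleton ℂ B 1) := by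
      ext a b
      have := hF a b
      simp only [LinearMap.comp_apply, LinearMap.sub_apply, LinearMap.flip_apply,
        LinearMap.compl₁₂_apply, LinearMap.compr₂_apply, LinearMap.mul_apply',
        Finsupp.lsingle_apply, hlin, one_smul, LinearMap.toSpanSingleton_apply]
      exact this
    intro f g
    exact congrArg (fun φ => φ f g) this
  let hom : Heis d →ₗ⁅ℂ⁆ B :=
    { (LinearMap.coprod lin (LinearMap.toSpanSingleton ℂ _ 1) :
        ((Fin d × ℤ →₀ ℂ) × ℂ) →ₗ[ℂ] B) with
      map_lie' := by
        rintro ⟨f, s⟩ ⟨g, t⟩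
        change LinearMap.coprod _ _ ((0, heisForm d f g) : (Fin d × ℤ →₀ ℂ) × ℂ) =
          ⁅LinearMap.coprod _ _ (f, s), LinearMap.coprod _ _ (g, t)⁆
        simp only [LinearMap.coprod_apply, map_zero, zero_add, LinearMap.toSpanSingleton_apply]
        rw [← hcomm, LieRing.of_associative_ring_bracket]
        simp only [add_mul, mul_add, smul_mul_assoc, mul_smul_comm, one_mul, mul_one,
          smul_add, smul_comm s t]
        abel }
  have hv : ∀ i m, hom (Heis.v i m) = F (i, m) := by
    intro i m
    change LinearMap.coprod _ _ ((Finsupp.single (i, m) 1, 0) : (Fin d × ℤ →₀ ℂ) × ℂ) = _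
    simp [hlin]
  have hc : hom Heis.c = 1 := by
    change LinearMap.coprod _ _ ((0, 1) : (Fin d × ℤ →₀ ℂ) × ℂ) = _
    simp
  refine ⟨RingQuot.liftAlgHom ℂ ⟨UniversalEnvelopingAlgebra.lift ℂ hom, ?_⟩, fun i m => ?_⟩
  · rintro _ _ ⟨⟩
    rw [UniversalEnvelopingAlgebra.lift_ι_apply, hc, map_one]
  · refine Eq.trans ?_ ((UniversalEnvelopingAlgebra.lift_ι_apply ℂ hom (Heis.v i m)).trans (hv i m))
    exact RingQuot.liftAlgHom_mkAlgHom_apply ℂ _ _ _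

/-- The vacuum expectation value of `v^i(m) v^j(n)`. -/
def vacForm {d : ℕ} (a b : Fin d × ℤ) : ℂ := if 0 < a.2 then contr a.1 b.1 a.2 b.2 else 0

theorem heisForm_single_eq_contr {d : ℕ} (a b : Fin d × ℤ) :
    heisForm d (Finsupp.single a 1) (Finsupp.single b 1) = contr a.1 b.1 a.2 b.2 :=
  heisForm_single d a b

theorem contr_swap {d : ℕ} (i j : Fin d) (m n : ℤ) : contr j i n m = -contr i j m n := by
  simp only [contr]
  by_cases h : i = j ∧ m + n = 0
  · rw [if_pos h, if_pos ⟨h.1.symm, by omega⟩, show n = -m by omega]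
    push_cast
    ring
  · rw [if_neg h, if_neg (fun h' => h ⟨h'.1.symm, by omega⟩), neg_zero]

theorem vacForm_sub_swap {d : ℕ} (a b : Fin d × ℤ) :
    vacForm a b - vacForm b a = contr a.1 b.1 a.2 b.2 := by
  rw [vacForm, vacForm, contr_swap a.1 b.1]
  by_cases h : a.1 = b.1 ∧ a.2 + b.2 = 0
  · split_ifs with h1 h2 h2
    · omega
    · ring
    · ring
    · have : contr a.1 b.1 a.2 b.2 = 0 := by
        rw [contr, if_pos h]
        exact_mod_cast (by omega : a.2 = 0)
      rw [this, sub_zero]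
  · have : contr a.1 b.1 a.2 b.2 = 0 := if_neg h
    simp [this]

theorem exists_linearMap_mvPolynomial {I M : Type*} [AddCommGroup M] [Module ℂ M]
    (F : I → I → M) (hF : ∀ a b, F a b = F b a) (m₀ : M) :
    ∃ T : MvPolynomial I ℂ →ₗ[ℂ] M,
      (∀ a b, T (MvPolynomial.X a * MvPolynomial.X b) = F a b) ∧ T 1 = m₀ := by
  classical
  -- The two factors of a quadratic monomial are unique up to order, so symmetry of `F` makes the
  -- choice harmless. The default value `m₀` is the one wanted at the monomial `1`; elsewhere it
  -- does not matter.
  let val : (I →₀ ℕ) → M := fun m =>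
    if h : ∃ c : I × I, m = Finsupp.single c.1 1 + Finsupp.single c.2 1 then
      F h.choose.1 h.choose.2 else m₀
  refine ⟨(MvPolynomial.basisMonomials I ℂ).constr ℂ val, fun a b => ?_, ?_⟩
  · have h : ∃ c : I × I, (Finsupp.single a 1 + Finsupp.single b 1 : I →₀ ℕ) =
        Finsupp.single c.1 1 + Finsupp.single c.2 1 := ⟨(a, b), rfl⟩
    have e : (MvPolynomial.X a * MvPolynomial.X b : MvPolynomial I ℂ) =
        MvPolynomial.basisMonomials I ℂ (Finsupp.single a 1 + Finsupp.single b 1) := by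
      simp [MvPolynomial.X, MvPolynomial.monomial_mul]
    rw [e, Module.Basis.constr_basis]
    change dite _ _ _ = _
    rw [dif_pos h]
    have := h.choose_spec
    rw [Finsupp.single_add_single_eq_single_add_single one_ne_zero one_ne_zero] at this
    generalize h.choose = c at this
    simp at this
    rcases this with ⟨h1, h2⟩ | ⟨h1, h2⟩
    · rw [← h1, ← h2]
    · rw [← h1, ← h2, hF]
  · have e : (1 : MvPolynomial I ℂ) = MvPolynomial.basisMonomials I ℂ 0 := by simp
    have h : ¬∃ c : I × I, (0 : I →₀ ℕ) = Finsupp.single c.1 1 + Finsupp.single c.2 1 := by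
      rintro ⟨c, hc⟩
      have := congrArg (fun f => f c.1) hc
      simp only [Finsupp.coe_zero, Pi.zero_apply, Finsupp.coe_add, Pi.add_apply,
        Finsupp.single_eq_same] at this
      omega
    rw [e, Module.Basis.constr_basis]
    exact dif_neg h

/-- The derivation by which `v^i(m)` contracts. -/
def contrDer {d : ℕ} (a : Fin d × ℤ) :
    Derivation ℂ (MvPolynomial (Fin d × ℤ) ℂ) (MvPolynomial (Fin d × ℤ) ℂ) :=
  MvPolynomial.mkDerivation ℂ fun c => MvPolynomial.C (vacForm a c)

theorem contrDer_X {d : ℕ} (a c : Fin d × ℤ) :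
    contrDer a (MvPolynomial.X c) = MvPolynomial.C (vacForm a c) :=
  MvPolynomial.mkDerivation_X ℂ _ c

/-- Both derivations send variables to constants. -/
theorem contrDer_comm {d : ℕ} (a b : Fin d × ℤ) (f : MvPolynomial (Fin d × ℤ) ℂ) :
    contrDer a (contrDer b f) = contrDer b (contrDer a f) := by
  have h : ⁅contrDer a, contrDer b⁆ = 0 := by
    apply MvPolynomial.derivation_ext
    intro c
    simp [Derivation.commutator_apply, contrDer_X, ← MvPolynomial.algebraMap_eq]
  have h' := congrArg (fun D : Derivation ℂ (MvPolynomial (Fin d × ℤ) ℂ)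
    (MvPolynomial (Fin d × ℤ) ℂ) => D f) h
  simpa [Derivation.commutator_apply, sub_eq_zero] using h'

/-- A linear map on `Span 𝓑 ⊕ ℂ` may be prescribed on the `v^{ij}(m,n)` and on `1`, subject only
to the commutation relations. -/
theorem exists_linearMap_spaceL {d : ℕ} {M : Type*} [AddCommGroup M] [Module ℂ M]
    (F : Fin d × ℤ → Fin d × ℤ → M) (m₀ : M)
    (hF : ∀ a b, F a b - F b a = contr a.1 b.1 a.2 b.2 • m₀) :
    ∃ T : HeisAlg d →ₗ[ℂ] M, (∀ a b, T (quad a.1 b.1 a.2 b.2) = F a b) ∧ T 1 = m₀ := by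
  -- Here every mode, nonnegative ones included, acts as multiplication by its own variable plus a
  -- contraction. Applied to `1`, the product `v^i(m) v^j(n)` becomes `X_a X_b` plus its vacuum
  -- expectation, so no quadratic element is lost. It remains to prescribe the values `F a b -
  -- vacForm a b • m₀`, which are symmetric by `hF`.
  obtain ⟨ψ, hψ⟩ := exists_heisAlg_lift (d := d)
    (fun a => LinearMap.mulLeft ℂ (MvPolynomial.X a) + (contrDer a).toLinearMap) (by
      intro a b
      rw [heisForm_single_eq_contr, ← vacForm_sub_swap]
      refine LinearMap.ext fun f => ?_
      simp only [LinearMap.sub_apply, Module.End.mul_apply, LinearMap.add_apply,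
        LinearMap.mulLeft_apply, Derivation.coeFn_coe, map_add, Derivation.leibniz, contrDer_X,
        contrDer_comm b a, LinearMap.smul_apply, Module.End.one_apply, smul_eq_mul,
        MvPolynomial.smul_eq_C_mul, map_sub]
      ring)
  obtain ⟨T, hT, hT1⟩ := exists_linearMap_mvPolynomial (fun a b => F a b - vacForm a b • m₀)
    (fun a b => by
      rw [sub_eq_sub_iff_sub_eq_sub, hF, ← sub_smul, vacForm_sub_swap]) m₀
  refine ⟨T ∘ₗ LinearMap.applyₗ (1 : MvPolynomial (Fin d × ℤ) ℂ) ∘ₗ ψ.toLinearMap,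
    fun a b => ?_, ?_⟩
  · have h : ψ (quad a.1 b.1 a.2 b.2) 1 = MvPolynomial.X a * MvPolynomial.X b +
        vacForm a b • 1 := by
      rw [quad, map_mul, hψ, hψ]
      simp [contrDer_X, MvPolynomial.smul_eq_C_mul]
    change T (ψ (quad a.1 b.1 a.2 b.2) 1) = _
    rw [h, map_add, hT, map_smul, hT1, sub_add_cancel]
  · change T (ψ 1 1) = _
    rw [map_one ψ, Module.End.one_apply, hT1]

/-! ### Brackets in `𝓛_r` -/

/-- The element `v^{ij}(m,n)` of `𝓛_r`, with the indices grouped as `(i,m)` and `(j,n)`. -/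
def pairL {d : ℕ} (r : ℂ) (a b : Fin d × ℤ) : Lr d r := vij r a.1 b.1 a.2 b.2

/-- The commutator `[v^i(m), v^j(n)]`, with the indices grouped as `(i,m)` and `(j,n)`. -/
def contrP {d : ℕ} (a b : Fin d × ℤ) : ℂ := contr a.1 b.1 a.2 b.2

/-- The element `1` of `𝓛_r`. -/
def oneLr (d : ℕ) (r : ℂ) : Lr d r := (Lr.toL d r).symm (oneL d)

theorem toL_pairL {d : ℕ} (r : ℂ) (a b : Fin d × ℤ) :
    (Lr.toL d r (pairL r a b) : HeisAlg d) = quad a.1 b.1 a.2 b.2 := rfl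

theorem toL_injective {d : ℕ} {r : ℂ} {x y : Lr d r}
    (h : (Lr.toL d r x : HeisAlg d) = Lr.toL d r y) : x = y :=
  (Lr.toL d r).injective (Subtype.ext h)

theorem vacForm_eq_zero {d : ℕ} {a b : Fin d × ℤ} (h : a.1 < b.1 ∨ a.1 = b.1 ∧ a.2 ≤ b.2) :
    vacForm a b = 0 := by
  rw [vacForm, ite_eq_right_iff]
  intro h0
  refine if_neg ?_
  rintro ⟨h1, h2⟩
  rcases h with h | h
  · exact h.ne h1
  · omega

theorem vacExp_quad {d : ℕ} (a b : Fin d × ℤ) :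
    vacExp d (quad a.1 b.1 a.2 b.2) = vacForm a b := by
  have key : ∀ a b : Fin d × ℤ, (a.1 < b.1 ∨ a.1 = b.1 ∧ a.2 ≤ b.2) →
      vacExp d (quad a.1 b.1 a.2 b.2) = 0 := by
    rintro ⟨i, m⟩ ⟨j, n⟩ h
    refine vacExp_of_mem_setB ?_
    rcases h with h | ⟨h, h'⟩
    · exact Or.inr ⟨i, j, m, n, h, rfl⟩
    · dsimp only at h h'
      subst h
      exact Or.inl ⟨i, m, n, h', rfl⟩
  by_cases h : a.1 < b.1 ∨ a.1 = b.1 ∧ a.2 ≤ b.2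
  · rw [key a b h, vacForm_eq_zero h]
  · have h' : b.1 < a.1 ∨ b.1 = a.1 ∧ b.2 ≤ a.2 := by
      rcases lt_trichotomy a.1 b.1 with h1 | h1 | h1
      · exact absurd (Or.inl h1) h
      · exact Or.inr ⟨h1.symm, by by_contra hc; exact h (Or.inr ⟨h1, by omega⟩)⟩
      · exact Or.inl h1
    have h2 := vacForm_sub_swap a b
    rw [vacForm_eq_zero h', sub_zero] at h2
    rw [quad_swap, map_add, key b a h', zero_add, Algebra.algebraMap_eq_smul_one, map_smul,
      vacExp_one, smul_eq_mul, mul_one, h2]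
    rfl

theorem pairL_swap {d : ℕ} (r : ℂ) (a b : Fin d × ℤ) :
    pairL r a b = pairL r b a + contrP a b • oneLr d r := by
  apply toL_injective
  rw [toL_pairL, quad_swap, Algebra.algebraMap_eq_smul_one]
  rfl

/-- The rescaled bracket adds `r - 1` times the projection `π₂` of the commutator, and `π₂` is
computed on each of the four quadratic terms by the vacuum expectation. -/
theorem lie_pairL {d : ℕ} (r : ℂ) (a b c e : Fin d × ℤ) :
    ⁅pairL r a b, pairL r c e⁆ =
      contrP b c • pairL r a e + contrP a c • pairL r b e + contrP b e • pairL r c a +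
        contrP a e • pairL r c b +
      ((r - 1) * (contrP b c * vacForm a e + contrP a c * vacForm b e + contrP b e * vacForm c a +
        contrP a e * vacForm c b)) • oneLr d r := by
  apply toL_injective
  have h : ((commL (Lr.toL d r (pairL r a b)) (Lr.toL d r (pairL r c e)) : spaceL d) : HeisAlg d) =
      contrP b c • quad a.1 e.1 a.2 e.2 + contrP a c • quad b.1 e.1 b.2 e.2 +
        contrP b e • quad c.1 a.1 c.2 a.2 + contrP a e • quad c.1 b.1 c.2 b.2 :=
    quad_comm _ _ _ _ _ _ _ _
  rw [Lr.toL_lie, rescale_eq, pi2_eq_vacExp, h]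
  simp only [map_add, map_smul, vacExp_quad, smul_eq_mul]
  change ((commL (Lr.toL d r (pairL r a b)) (Lr.toL d r (pairL r c e)) : spaceL d) : HeisAlg d) +
    _ • (1 : HeisAlg d) = _
  rw [h]
  rfl

theorem oneLr_lie {d : ℕ} {r : ℂ} (x : Lr d r) : ⁅oneLr d r, x⁆ = 0 := by
  have h : commL (Lr.toL d r (oneLr d r)) (Lr.toL d r x) = 0 := by
    apply Subtype.ext
    change (1 : HeisAlg d) * _ - _ * (1 : HeisAlg d) = 0
    rw [one_mul, mul_one, sub_self]
  apply (Lr.toL d r).injective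
  rw [Lr.toL_lie, h, map_zero, map_zero]

theorem span_pairL (d : ℕ) (r : ℂ) :
    Submodule.span ℂ ((Set.range fun c : (Fin d × ℤ) × (Fin d × ℤ) => pairL r c.1 c.2) ∪
      {oneLr d r}) = ⊤ := by
  rw [Submodule.eq_top_iff']
  have key : ∀ y ∈ spaceL d, ∀ x : Lr d r, (Lr.toL d r x : HeisAlg d) = y →
      x ∈ Submodule.span ℂ ((Set.range fun c : (Fin d × ℤ) × (Fin d × ℤ) => pairL r c.1 c.2) ∪
        {oneLr d r}) := by
    intro y hy
    rw [spaceL, ← Submodule.span_union] at hy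
    induction hy using Submodule.span_induction with
    | zero =>
      intro x hx
      rw [toL_injective (y := (0 : Lr d r)) hx]
      exact zero_mem _
    | add a b ha hb iha ihb =>
      intro x hx
      rw [Submodule.span_union] at ha hb
      have : x = (Lr.toL d r).symm ⟨a, ha⟩ + (Lr.toL d r).symm ⟨b, hb⟩ := toL_injective hx
      rw [this]
      exact add_mem (iha _ rfl) (ihb _ rfl)
    | smul t a ha iha =>
      intro x hx
      rw [Submodule.span_union] at ha
      have : x = t • (Lr.toL d r).symm ⟨a, ha⟩ := toL_injective hx
      rw [this]
      exact Submodule.smul_mem _ _ (iha _ rfl)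
    | mem a ha =>
      intro x hx
      refine Submodule.subset_span ?_
      rcases ha with ha | ha
      · obtain ⟨i, j, m, n, rfl⟩ := setB_eq_quad ha
        exact Or.inl ⟨((i, m), (j, n)), (toL_injective hx).symm⟩
      · exact Or.inr (toL_injective (hx.trans ha))
  exact fun x => key _ (Lr.toL d r x).2 x rfl

/-! ### A family of modules on which the lowering operators are of first order

Polynomials in the entries of a symmetric matrix `Z` are acted on from the right by first order
differential operators; `𝓛_r` acts on linear functionals on these polynomials. -/

/-- The entries of the symmetric matrix `Z`, extended by zero. -/
def symVar {d : ℕ} (a b : Fin d × ℤ) : MvPolynomial (Sym2 (Fin d × ℤ)) ℂ :=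
  if 0 < a.2 ∧ 0 < b.2 then MvPolynomial.X s(a, b) else 0

/-- The two-point function. -/
def twoPt {d : ℕ} (a b : Fin d × ℤ) : MvPolynomial (Sym2 (Fin d × ℤ)) ℂ :=
  MvPolynomial.C (vacForm a b) + symVar a b

theorem symVar_swap {d : ℕ} (a b : Fin d × ℤ) : symVar a b = symVar b a := by
  rw [symVar, symVar, Sym2.eq_swap]
  simp only [and_comm]

theorem twoPt_swap {d : ℕ} (a b : Fin d × ℤ) :
    twoPt a b = twoPt b a + MvPolynomial.C (contrP a b) := by
  rw [twoPt, twoPt, symVar_swap, contrP, ← vacForm_sub_swap, map_sub]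
  ring

theorem symVar_of_not_pos {d : ℕ} {a b : Fin d × ℤ} (h : ¬(0 < a.2 ∧ 0 < b.2)) :
    symVar a b = 0 := if_neg h

theorem vacForm_of_nonpos_left {d : ℕ} {a : Fin d × ℤ} (b : Fin d × ℤ) (h : a.2 ≤ 0) :
    vacForm a b = 0 := if_neg (not_lt.mpr h)

theorem twoPt_of_nonpos {d : ℕ} (a b : Fin d × ℤ) (h : a.2 ≤ 0) : twoPt a b = 0 := by
  rw [twoPt, symVar_of_not_pos (fun h' => absurd h'.1 (not_lt.mpr h)), vacForm_of_nonpos_left b h,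
    map_zero, add_zero]

/-- The derivation part of the action of `v^{ij}(m,n)`. -/
def pairDer {d : ℕ} (a b : Fin d × ℤ) :
    Derivation ℂ (MvPolynomial (Sym2 (Fin d × ℤ)) ℂ) (MvPolynomial (Sym2 (Fin d × ℤ)) ℂ) :=
  MvPolynomial.mkDerivation ℂ (Sym2.lift ⟨fun c e => twoPt c a * twoPt e b + twoPt e a * twoPt c b,
    fun _ _ => add_comm _ _⟩)

theorem pairDer_X {d : ℕ} (a b c e : Fin d × ℤ) : pairDer a b (MvPolynomial.X s(c, e)) =
    twoPt c a * twoPt e b + twoPt e a * twoPt c b :=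
  MvPolynomial.mkDerivation_X ℂ _ _

/-- The rule for variables persists for the entries set to zero: each product on the right contains
a two-point function with first index `c` and one with first index `e`, and these vanish when that
index has a nonpositive mode. -/
theorem pairDer_symVar {d : ℕ} (a b c e : Fin d × ℤ) : pairDer a b (symVar c e) =
    twoPt c a * twoPt e b + twoPt e a * twoPt c b := by
  rw [symVar]
  split_ifs with h
  · exact pairDer_X a b c e
  · rw [map_zero]
    by_cases hc : c.2 ≤ 0
    · rw [twoPt_of_nonpos c _ hc, twoPt_of_nonpos c _ hc]; ring
    · rw [twoPt_of_nonpos e _ (by omega), twoPt_of_nonpos e _ (by omega)]; ring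

theorem pairDer_twoPt {d : ℕ} (a b c e : Fin d × ℤ) : pairDer a b (twoPt c e) =
    twoPt c a * twoPt e b + twoPt e a * twoPt c b := by
  rw [twoPt, map_add, ← MvPolynomial.algebraMap_eq, Derivation.map_algebraMap, zero_add,
    pairDer_symVar]

theorem pairDer_swap {d : ℕ} (a b : Fin d × ℤ) : pairDer a b = pairDer b a := by
  apply MvPolynomial.derivation_ext
  intro s
  induction s using Sym2.ind with
  | _ c e => rw [pairDer_X, pairDer_X]; ring

/-- On two-point functions the derivations are quadratic, as in Wick's theorem. In the commutator
everything cancels except the differences between a two-point function and its swap, which are the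
contractions. The order of the factors is reversed because this is a right action. -/
theorem pairDer_comm {d : ℕ} (a b c e : Fin d × ℤ) :
    ⁅pairDer c e, pairDer a b⁆ = contrP b c • pairDer a e + contrP a c • pairDer b e +
      contrP b e • pairDer c a + contrP a e • pairDer c b := by
  apply MvPolynomial.derivation_ext
  intro s
  induction s using Sym2.ind with
  | _ x y =>
    simp only [Derivation.commutator_apply, pairDer_X, map_add, Derivation.leibniz, pairDer_twoPt,
      Derivation.add_apply, Derivation.smul_apply, MvPolynomial.smul_eq_C_mul, smul_eq_mul]
    rw [twoPt_swap b c, twoPt_swap a c, twoPt_swap b e, twoPt_swap a e]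
    ring

/-- The operator by which `v^{ij}(m,n)` acts on polynomials from the right. -/
def pairOp {d : ℕ} (r : ℂ) (a b : Fin d × ℤ) :
    Module.End ℂ (MvPolynomial (Sym2 (Fin d × ℤ)) ℂ) :=
  (pairDer a b).toLinearMap +
    LinearMap.mulLeft ℂ (MvPolynomial.C r * symVar a b + MvPolynomial.C (vacForm a b))

theorem pairOp_apply {d : ℕ} (r : ℂ) (a b : Fin d × ℤ) (f : MvPolynomial (Sym2 (Fin d × ℤ)) ℂ) :
    pairOp r a b f = pairDer a b f +
      (MvPolynomial.C r * symVar a b + MvPolynomial.C (vacForm a b)) * f := rfl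

theorem pairOp_sub_swap {d : ℕ} (r : ℂ) (a b : Fin d × ℤ) :
    pairOp r a b - pairOp r b a = contr a.1 b.1 a.2 b.2 • 1 := by
  refine LinearMap.ext fun f => ?_
  rw [LinearMap.sub_apply, pairOp_apply, pairOp_apply, pairDer_swap, symVar_swap,
    ← vacForm_sub_swap, LinearMap.smul_apply, Module.End.one_apply, MvPolynomial.smul_eq_C_mul,
    map_sub]
  ring

/-- The terms of order zero produce `r` times contracted two-point functions, that is, `r` times
`symVar` plus `r` times `vacForm`. The operators on the right carry `r` times `symVar` but `vacForm`
only once; the excess `r - 1` is the central term of `lie_pairL`. -/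
theorem pairOp_comm {d : ℕ} (r : ℂ) (a b c e : Fin d × ℤ) :
    pairOp r c e * pairOp r a b - pairOp r a b * pairOp r c e =
      contrP b c • pairOp r a e + contrP a c • pairOp r b e + contrP b e • pairOp r c a +
        contrP a e • pairOp r c b +
      ((r - 1) * (contrP b c * vacForm a e + contrP a c * vacForm b e + contrP b e * vacForm c a +
        contrP a e * vacForm c b)) • 1 := by
  refine LinearMap.ext fun f => ?_
  have h := congrArg (fun D : Derivation ℂ (MvPolynomial (Sym2 (Fin d × ℤ)) ℂ)
    (MvPolynomial (Sym2 (Fin d × ℤ)) ℂ) => D f) (pairDer_comm a b c e)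
  simp only [Derivation.commutator_apply, Derivation.add_apply, Derivation.smul_apply,
    MvPolynomial.smul_eq_C_mul] at h
  have hC : ∀ x y : Fin d × ℤ, ∀ z : ℂ, pairDer x y (MvPolynomial.C z) = 0 := fun x y z =>
    (pairDer x y).map_algebraMap z
  have hS : ∀ x y : Fin d × ℤ, symVar x y = twoPt x y - MvPolynomial.C (vacForm x y) := fun x y =>
    (add_sub_cancel_left _ _).symm
  have h1 := twoPt_swap b c
  have h2 := twoPt_swap a c
  have h3 := twoPt_swap b e
  have h4 := twoPt_swap a e
  simp only [LinearMap.sub_apply, LinearMap.add_apply, LinearMap.smul_apply, Module.End.mul_apply,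
    Module.End.one_apply, pairOp_apply, map_add, Derivation.leibniz, hC, pairDer_symVar,
    smul_eq_mul, MvPolynomial.smul_eq_C_mul, map_mul, map_sub, map_one]
  rw [hS a e, hS b e, hS c a, hS c b]
  linear_combination h + MvPolynomial.C r * f * (twoPt a e * h1 + twoPt b e * h2 +
    twoPt c a * h3 + twoPt c b * h4)

theorem exists_rightAction (d : ℕ) (r : ℂ) :
    ∃ T : HeisAlg d →ₗ[ℂ] Module.End ℂ (MvPolynomial (Sym2 (Fin d × ℤ)) ℂ),
      (∀ a b, T (quad a.1 b.1 a.2 b.2) = pairOp r a b) ∧ T 1 = 1 :=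
  exists_linearMap_spaceL (pairOp r) 1 (pairOp_sub_swap r)

/-- The right action of `𝓛_r` on polynomials. -/
def rightAction (d : ℕ) (r : ℂ) :
    HeisAlg d →ₗ[ℂ] Module.End ℂ (MvPolynomial (Sym2 (Fin d × ℤ)) ℂ) :=
  (exists_rightAction d r).choose

theorem rightAction_quad {d : ℕ} (r : ℂ) (a b : Fin d × ℤ) :
    rightAction d r (quad a.1 b.1 a.2 b.2) = pairOp r a b :=
  (exists_rightAction d r).choose_spec.1 a b

theorem rightAction_one (d : ℕ) (r : ℂ) : rightAction d r 1 = 1 :=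
  (exists_rightAction d r).choose_spec.2

theorem rightAction_lie {d : ℕ} {r : ℂ} (x y : Lr d r) :
    rightAction d r (Lr.toL d r ⁅x, y⁆) =
      rightAction d r (Lr.toL d r y) * rightAction d r (Lr.toL d r x) -
        rightAction d r (Lr.toL d r x) * rightAction d r (Lr.toL d r y) := by
  let S : Lr d r →ₗ[ℂ] Module.End ℂ (MvPolynomial (Sym2 (Fin d × ℤ)) ℂ) :=
    rightAction d r ∘ₗ (spaceL d).subtype ∘ₗ (Lr.toL d r).toLinearMap
  have hS : ∀ a b, S (pairL r a b) = pairOp r a b := fun a b => rightAction_quad r a b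
  have hS1 : S (oneLr d r) = 1 := rightAction_one d r
  change S ⁅x, y⁆ = S y * S x - S x * S y
  have hx : x ∈ Submodule.span ℂ _ := (span_pairL d r).symm ▸ Submodule.mem_top
  have hy : y ∈ Submodule.span ℂ _ := (span_pairL d r).symm ▸ Submodule.mem_top
  induction hx using Submodule.span_induction with
  | zero => simp
  | add a b _ _ ha hb => rw [add_lie, map_add, map_add, ha, hb, mul_add, add_mul]; abel
  | smul t a _ ha =>
    rw [smul_lie, map_smul, map_smul, ha, mul_smul_comm, smul_mul_assoc, smul_sub]
  | mem x hx =>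
    induction hy using Submodule.span_induction with
    | zero => simp
    | add a b _ _ ha hb => rw [lie_add, map_add, map_add, ha, hb, mul_add, add_mul]; abel
    | smul t a _ ha =>
      rw [lie_smul, map_smul, map_smul, ha, mul_smul_comm, smul_mul_assoc, smul_sub]
    | mem y hy =>
      rcases hx with ⟨⟨a, b⟩, rfl⟩ | rfl
      · rcases hy with ⟨⟨c, e⟩, rfl⟩ | rfl
        · dsimp only
          rw [hS, hS, pairOp_comm, lie_pairL]
          simp only [map_add, map_smul, hS, hS1]
        · rw [← lie_skew, oneLr_lie, neg_zero, map_zero, hS1, one_mul, mul_one, sub_self]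
      · rw [oneLr_lie, map_zero, hS1, one_mul, mul_one, sub_self]

/-- The action of `𝓛_r` on linear functionals on polynomials. -/
def dualAction (d : ℕ) (r : ℂ) :
    Lr d r →ₗ⁅ℂ⁆ Module.End ℂ (Module.Dual ℂ (MvPolynomial (Sym2 (Fin d × ℤ)) ℂ)) :=
  { Module.Dual.transpose ∘ₗ rightAction d r ∘ₗ (spaceL d).subtype ∘ₗ
      (Lr.toL d r).toLinearMap with
    map_lie' := by
      intro x y
      refine LinearMap.ext fun ξ => LinearMap.ext fun f => ?_
      change ξ (rightAction d r (Lr.toL d r ⁅x, y⁆) f) = _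
      rw [rightAction_lie, LinearMap.sub_apply, map_sub]
      rfl }

theorem dualAction_apply {d : ℕ} {r : ℂ} (x : Lr d r)
    (ξ : Module.Dual ℂ (MvPolynomial (Sym2 (Fin d × ℤ)) ℂ))
    (f : MvPolynomial (Sym2 (Fin d × ℤ)) ℂ) :
    dualAction d r x ξ f = ξ (rightAction d r (Lr.toL d r x) f) := rfl

/-- The action of `U(𝓛_r)` on linear functionals on polynomials. -/
def uDualAction (d : ℕ) (r : ℂ) :
    ULr d r →ₐ[ℂ] Module.End ℂ (Module.Dual ℂ (MvPolynomial (Sym2 (Fin d × ℤ)) ℂ)) :=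
  UniversalEnvelopingAlgebra.lift ℂ (dualAction d r)

theorem uDualAction_ι {d : ℕ} {r : ℂ} (x : Lr d r) :
    uDualAction d r (UniversalEnvelopingAlgebra.ι ℂ x) = dualAction d r x :=
  UniversalEnvelopingAlgebra.lift_ι_apply ℂ _ x

/-- The constant coefficient. -/
def constFun (d : ℕ) : Module.Dual ℂ (MvPolynomial (Sym2 (Fin d × ℤ)) ℂ) :=
  (MvPolynomial.aeval (fun _ : Sym2 (Fin d × ℤ) => (0 : ℂ))).toLinearMap

theorem constFun_mul {d : ℕ} (f g : MvPolynomial (Sym2 (Fin d × ℤ)) ℂ) :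
    constFun d (f * g) = constFun d f * constFun d g :=
  map_mul (MvPolynomial.aeval (fun _ : Sym2 (Fin d × ℤ) => (0 : ℂ))) f g

theorem constFun_C {d : ℕ} (z : ℂ) : constFun d (MvPolynomial.C z) = z :=
  MvPolynomial.aeval_C _ z

theorem constFun_X {d : ℕ} (s : Sym2 (Fin d × ℤ)) : constFun d (MvPolynomial.X s) = 0 :=
  MvPolynomial.aeval_X _ s

theorem constFun_symVar {d : ℕ} (a b : Fin d × ℤ) : constFun d (symVar a b) = 0 := by
  rw [symVar]
  split_ifs
  · exact constFun_X _
  · exact map_zero _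

theorem constFun_twoPt {d : ℕ} (a b : Fin d × ℤ) : constFun d (twoPt a b) = vacForm a b := by
  rw [twoPt, map_add, constFun_symVar, constFun_C, add_zero]

theorem vacForm_of_nonneg_right {d : ℕ} (a b : Fin d × ℤ) (h : 0 ≤ b.2) : vacForm a b = 0 := by
  rw [vacForm, contr]
  split_ifs with h1 h2
  · omega
  · rfl
  · rfl

/-- At `Z = 0` the image of a variable is a sum of products of values of `vacForm` with `a` and `b`
as second indices, and `vacForm` vanishes when the second mode is nonnegative. -/
theorem constFun_pairDer {d : ℕ} (a b : Fin d × ℤ) (h : 0 ≤ a.2 ∨ 0 ≤ b.2)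
    (f : MvPolynomial (Sym2 (Fin d × ℤ)) ℂ) : constFun d (pairDer a b f) = 0 := by
  induction f using MvPolynomial.induction_on with
  | C z =>
    rw [← MvPolynomial.algebraMap_eq, Derivation.map_algebraMap, map_zero]
  | add f g hf hg => rw [map_add, map_add, hf, hg, add_zero]
  | mul_X f s hf =>
    rw [Derivation.leibniz, map_add, smul_eq_mul, smul_eq_mul, constFun_mul, constFun_mul, hf,
      mul_zero, add_zero]
    induction s using Sym2.ind with
    | _ c e =>
      rw [pairDer_X, map_add, constFun_mul, constFun_mul, constFun_twoPt, constFun_twoPt,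
        constFun_twoPt, constFun_twoPt]
      rcases h with h | h
      · simp [vacForm_of_nonneg_right _ a h]
      · simp [vacForm_of_nonneg_right _ b h]

theorem constFun_rightAction {d : ℕ} (r : ℂ) {x : HeisAlg d} (hx : x ∈ spaceLPlus d)
    (f : MvPolynomial (Sym2 (Fin d × ℤ)) ℂ) :
    constFun d (rightAction d r x f) = vacExp d x * constFun d f := by
  rw [spaceLPlus, ← Submodule.span_union] at hx
  induction hx using Submodule.span_induction with
  | zero => simp
  | add a b _ _ ha hb => rw [map_add, map_add, LinearMap.add_apply, map_add, ha, hb, add_mul]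
  | smul t a _ ha =>
    rw [map_smul, map_smul, LinearMap.smul_apply, map_smul, ha, smul_eq_mul, smul_eq_mul, mul_assoc]
  | mem x hx =>
    rcases hx with hx | hx
    · rw [vacExp_of_mem_setB (setBPlus_subset d hx), zero_mul]
      have key : ∀ a b : Fin d × ℤ, (a.1 < b.1 ∨ a.1 = b.1 ∧ a.2 ≤ b.2) → (0 ≤ a.2 ∨ 0 ≤ b.2) →
          constFun d (rightAction d r (quad a.1 b.1 a.2 b.2) f) = 0 := by
        intro a b h h'
        rw [rightAction_quad, pairOp_apply, vacForm_eq_zero h, map_add, constFun_pairDer a b h',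
          constFun_mul, map_zero, add_zero, constFun_mul, constFun_symVar, mul_zero, zero_mul,
          add_zero]
      rcases hx with ⟨i, m, n, h, h', rfl⟩ | ⟨i, j, m, n, h, h', rfl⟩
      · exact key (i, m) (i, n) (Or.inr ⟨rfl, h⟩) h'
      · exact key (i, m) (j, n) (Or.inl h) h'
    · rw [Set.mem_singleton_iff.mp hx, rightAction_one, Module.End.one_apply, vacExp_one, one_mul]

/-- The universal property gives a homomorphism into `S` whose composition with the inclusion agrees
with the identity on the generators. It serves as an induction principle. -/
theorem universalEnveloping_mem {L : Type*} [LieRing L] [LieAlgebra ℂ L]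
    (S : Subalgebra ℂ (UniversalEnvelopingAlgebra ℂ L))
    (h : ∀ x, UniversalEnvelopingAlgebra.ι ℂ x ∈ S) (a : UniversalEnvelopingAlgebra ℂ L) :
    a ∈ S := by
  let g : L →ₗ⁅ℂ⁆ S :=
    { toFun := fun x => ⟨UniversalEnvelopingAlgebra.ι ℂ x, h x⟩
      map_add' := fun x y => Subtype.ext (map_add _ _ _)
      map_smul' := fun t x => Subtype.ext (map_smul _ _ _)
      map_lie' := fun {x y} => Subtype.ext (LieHom.map_lie _ _ _) }
  have e : S.val.comp (UniversalEnvelopingAlgebra.lift ℂ g) = AlgHom.id ℂ _ := by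
    apply UniversalEnvelopingAlgebra.hom_ext
    refine LieHom.ext fun x => ?_
    change S.val (UniversalEnvelopingAlgebra.lift ℂ g (UniversalEnvelopingAlgebra.ι ℂ x)) =
      UniversalEnvelopingAlgebra.ι ℂ x
    rw [UniversalEnvelopingAlgebra.lift_ι_apply]
    rfl
  have := congrArg (fun F : UniversalEnvelopingAlgebra ℂ L →ₐ[ℂ] _ => F a) e
  change ((UniversalEnvelopingAlgebra.lift ℂ g a : S) : UniversalEnvelopingAlgebra ℂ L) = a at this
  rw [← this]
  exact Subtype.property _

theorem uDualAction_constFun {d : ℕ} {r : ℂ} (a : UniversalEnvelopingAlgebra ℂ (LrPlus d r)) :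
    uDualAction d r (uIncl (LrPlus d r) a) (constFun d) = uVacChar d r a • constFun d := by
  let S : Subalgebra ℂ (UniversalEnvelopingAlgebra ℂ (LrPlus d r)) :=
    { carrier := {a | uDualAction d r (uIncl (LrPlus d r) a) (constFun d) =
        uVacChar d r a • constFun d}
      mul_mem' := by
        intro a b ha hb
        change _ = _ at ha hb
        change _ = _
        rw [map_mul, map_mul, map_mul, Module.End.mul_apply, hb, map_smul, ha, smul_smul, mul_comm]
      add_mem' := by
        intro a b ha hb
        change _ = _ at ha hb
        change _ = _
        rw [map_add, map_add, map_add, LinearMap.add_apply, ha, hb, add_smul]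
      algebraMap_mem' := by
        intro z
        change _ = _
        rw [AlgHom.commutes, AlgHom.commutes, AlgHom.commutes]
        rfl }
  refine universalEnveloping_mem S (fun x => ?_) a
  change uDualAction d r (uIncl (LrPlus d r) (UniversalEnvelopingAlgebra.ι ℂ x)) (constFun d) =
    uVacChar d r (UniversalEnvelopingAlgebra.ι ℂ x) • constFun d
  rw [uIncl_ι, uDualAction_ι, uVacChar, UniversalEnvelopingAlgebra.lift_ι_apply, vacChar_apply,
    pi2_eq_vacExp]
  exact LinearMap.ext fun f => constFun_rightAction r x.2 f

/-- The module `M_r` maps to linear functionals on polynomials. -/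
theorem exists_toDual (d : ℕ) (r : ℂ) :
    ∃ Ψ : Mr d r →+ Module.Dual ℂ (MvPolynomial (Sym2 (Fin d × ℤ)) ℂ),
      (∀ (u : ULr d r) (w : Mr d r), Ψ (u • w) = uDualAction d r u (Ψ w)) ∧
        Ψ (vac d r) = constFun d := by
  let _ : Module (ULr d r) (Module.Dual ℂ (MvPolynomial (Sym2 (Fin d × ℤ)) ℂ)) :=
    Module.compHom _ (uDualAction d r).toRingHom
  have hsmul : ∀ (u : ULr d r) (ξ : Module.Dual ℂ (MvPolynomial (Sym2 (Fin d × ℤ)) ℂ)),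
      u • ξ = uDualAction d r u ξ := fun _ _ => rfl
  let Λ : (ULr d r ⊗[ℂ] ℂ) →ₗ[ULr d r] Module.Dual ℂ (MvPolynomial (Sym2 (Fin d × ℤ)) ℂ) :=
    LinearMap.toSpanSingleton (ULr d r) _ (constFun d) ∘ₗ
      (TensorProduct.AlgebraTensorModule.rid ℂ (ULr d r) (ULr d r)).toLinearMap
  have hΛ : ∀ (u : ULr d r) (z : ℂ), Λ (u ⊗ₜ z) = z • uDualAction d r u (constFun d) := by
    intro u z
    change (TensorProduct.AlgebraTensorModule.rid ℂ (ULr d r) (ULr d r) (u ⊗ₜ z)) • constFun d = _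
    rw [TensorProduct.AlgebraTensorModule.rid_tmul, hsmul, map_smul]
    rfl
  have hker : indRel d r ≤ LinearMap.ker Λ := by
    refine Submodule.span_le.mpr ?_
    rintro _ ⟨u, a, z, rfl⟩
    change Λ _ = 0
    rw [map_sub, hΛ, hΛ, map_mul, Module.End.mul_apply, uDualAction_constFun, map_smul, smul_smul,
      mul_comm, sub_self]
  refine ⟨((indRel d r).liftQ Λ hker).toAddMonoidHom, fun u w => ?_, ?_⟩
  · exact ((indRel d r).liftQ Λ hker).map_smul u w
  · change (indRel d r).liftQ Λ hker ((indRel d r).mkQ _) = _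
    rw [Submodule.mkQ_apply, Submodule.liftQ_apply, hΛ, one_smul, map_one, Module.End.one_apply]

/-! ### The powers of the determinant do not vanish -/

/-- The hypothesis is asked for all functionals because, when the leftmost factor is evaluated, the
others have already changed `ξ`. -/
theorem listProd_apply_of_lowering {R : Type*} [AddCommGroup R] [Module ℂ R] (F : ℕ → R)
    (l : List (Module.End ℂ (Module.Dual ℂ R) × ℂ))
    (h : ∀ x ∈ l, ∀ ξ N, x.1 ξ (F (N + 1)) = x.2 * ξ (F N)) (ξ : Module.Dual ℂ R) (N : ℕ) :
    (l.map Prod.fst).prod ξ (F (N + l.length)) = (l.map Prod.snd).prod * ξ (F N) := by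
  induction l with
  | nil => simp
  | cons x l ih =>
    rw [List.map_cons, List.prod_cons, List.map_cons, List.prod_cons, List.length_cons,
      Module.End.mul_apply, ← add_assoc, h x List.mem_cons_self,
      ih fun y hy => h y (List.mem_cons_of_mem _ hy), mul_assoc]

section NonVanishing

variable (d : ℕ) [NeZero d] (p : ℕ)

/-- The sum of the first `p` diagonal variables. -/
def traceVar : MvPolynomial (Sym2 (Fin d × ℤ)) ℂ :=
  ∑ q : Fin p, symVar ((0 : Fin d), (q : ℤ) + 1) ((0 : Fin d), (q : ℤ) + 1)

/-- The divided powers of `traceVar`. -/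
def traceExp (N : ℕ) : MvPolynomial (Sym2 (Fin d × ℤ)) ℂ :=
  ((N.factorial : ℂ)⁻¹) • traceVar d p ^ N

variable {d p}

theorem vacForm_pos_neg (q s : Fin p) :
    vacForm ((0 : Fin d), (q : ℤ) + 1) ((0 : Fin d), -((s : ℤ) + 1)) =
      if q = s then (s : ℂ) + 1 else 0 := by
  rw [vacForm, if_pos (by dsimp only; omega), contr]
  by_cases h : q = s
  · rw [if_pos h, if_pos ⟨rfl, by rw [h]; dsimp only; omega⟩, h]
    push_cast
    rfl
  · rw [if_neg h, if_neg]
    rintro ⟨-, h'⟩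
    dsimp only at h'
    exact h (Fin.ext (by omega))

theorem pairDer_traceVar (s t : Fin p) :
    pairDer ((0 : Fin d), -((s : ℤ) + 1)) ((0 : Fin d), -((t : ℤ) + 1)) (traceVar d p) =
      MvPolynomial.C (if s = t then 2 * ((s : ℂ) + 1) ^ 2 else 0) := by
  have h : ∀ q s : Fin p, twoPt ((0 : Fin d), (q : ℤ) + 1) ((0 : Fin d), -((s : ℤ) + 1)) =
      MvPolynomial.C (if q = s then (s : ℂ) + 1 else 0) := by
    intro q s
    rw [twoPt, vacForm_pos_neg, symVar_of_not_pos (by dsimp only; omega), add_zero]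
  rw [traceVar, map_sum]
  simp only [pairDer_symVar, h, ← map_mul, ← map_add]
  rw [← map_sum]
  congr 1
  rw [Finset.sum_eq_single s]
  · by_cases hst : s = t
    · rw [if_pos rfl, if_pos hst, if_pos hst, hst]; ring
    · rw [if_neg hst, if_neg hst]; ring
  · intro q _ hq
    rw [if_neg hq]; ring
  · exact fun h => absurd (Finset.mem_univ s) h

theorem rightAction_v (r : ℂ) (m n : ℤ) :
    rightAction d r (Lr.toL d r (v r m n)) = pairOp r ((0 : Fin d), m) ((0 : Fin d), n) :=
  rightAction_quad r ((0 : Fin d), m) ((0 : Fin d), n)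

/-- For two negative modes the multiplication part of `pairOp` vanishes and the derivation sends the
trace to a constant; it therefore lowers divided powers by one step. -/
theorem uDualAction_traceExp_succ (r : ℂ) (s t : Fin p)
    (ξ : Module.Dual ℂ (MvPolynomial (Sym2 (Fin d × ℤ)) ℂ)) (N : ℕ) :
    uDualAction d r (UniversalEnvelopingAlgebra.ι ℂ (v r (-((s : ℤ) + 1)) (-((t : ℤ) + 1)))) ξ
      (traceExp d p (N + 1)) =
      (if s = t then 2 * ((s : ℂ) + 1) ^ 2 else 0) * ξ (traceExp d p N) := by
  have hz : MvPolynomial.C r * symVar ((0 : Fin d), -((s : ℤ) + 1)) ((0 : Fin d), -((t : ℤ) + 1)) +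
      MvPolynomial.C (vacForm ((0 : Fin d), -((s : ℤ) + 1)) ((0 : Fin d), -((t : ℤ) + 1))) = 0 := by
    rw [symVar_of_not_pos (by dsimp only; omega), vacForm_of_nonpos_left _ (by dsimp only; omega),
      map_zero, mul_zero, add_zero]
  rw [uDualAction_ι, dualAction_apply, rightAction_v, pairOp_apply, hz, zero_mul, add_zero,
    traceExp, Derivation.map_smul, Derivation.leibniz_pow, Nat.add_sub_cancel, pairDer_traceVar,
    Nat.factorial_succ, traceExp, smul_eq_mul, mul_comm (traceVar d p ^ N),
    ← MvPolynomial.smul_eq_C_mul, ← Nat.cast_smul_eq_nsmul ℂ, smul_smul, smul_smul, map_smul,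
    map_smul, smul_eq_mul, smul_eq_mul, ← mul_assoc]
  congr 1
  have h1 : ((N + 1 : ℕ) : ℂ) ≠ 0 := Nat.cast_ne_zero.mpr N.succ_ne_zero
  have h2 : (N.factorial : ℂ) ≠ 0 := Nat.cast_ne_zero.mpr N.factorial_ne_zero
  rw [Nat.cast_mul]
  field_simp

theorem uDualAction_traceExp_zero (r : ℂ) (s t : Fin p)
    (ξ : Module.Dual ℂ (MvPolynomial (Sym2 (Fin d × ℤ)) ℂ)) :
    uDualAction d r (UniversalEnvelopingAlgebra.ι ℂ (v r (-((s : ℤ) + 1)) (-((t : ℤ) + 1)))) ξ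
      (traceExp d p 0) = 0 := by
  rw [uDualAction_ι, dualAction_apply, rightAction_v, pairOp_apply,
    symVar_of_not_pos (by dsimp only; omega), vacForm_of_nonpos_left _ (by dsimp only; omega),
    map_zero, mul_zero, add_zero, zero_mul, add_zero,
    traceExp, pow_zero, Derivation.map_smul, Derivation.map_one_eq_zero, smul_zero, map_zero]

/-- On divided powers of the trace the entries of `V_p` act as those of the diagonal matrix with
entries `2 (q + 1) ^ 2`, each lowering the degree by one. -/
theorem uDualAction_detV (r : ℂ) (ξ : Module.Dual ℂ (MvPolynomial (Sym2 (Fin d × ℤ)) ℂ)) (N : ℕ) :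
    uDualAction d r (detV d r p) ξ (traceExp d p (N + p)) =
      (∏ q : Fin p, (2 * ((q : ℂ) + 1) ^ 2)) * ξ (traceExp d p N) := by
  let c : Fin p → ℂ := fun q => 2 * ((q : ℂ) + 1) ^ 2
  have hσ : ∀ σ : Equiv.Perm (Fin p), uDualAction d r (List.ofFn fun q : Fin p =>
      UniversalEnvelopingAlgebra.ι ℂ (v (d := d) r (-((q : ℤ) + 1)) (-((σ q : ℤ) + 1)))).prod ξ
      (traceExp d p (N + p)) = (∏ q, Matrix.diagonal c q (σ q)) * ξ (traceExp d p N) := by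
    intro σ
    have h := listProd_apply_of_lowering (traceExp d p) (List.ofFn fun q : Fin p =>
      (uDualAction d r (UniversalEnvelopingAlgebra.ι ℂ
        (v (d := d) r (-((q : ℤ) + 1)) (-((σ q : ℤ) + 1)))), Matrix.diagonal c q (σ q)))
      (by
        intro x hx ξ N
        obtain ⟨q, rfl⟩ := List.mem_ofFn.mp hx
        exact uDualAction_traceExp_succ r q (σ q) ξ N) ξ N
    rw [List.map_ofFn, List.map_ofFn, List.length_ofFn, List.prod_ofFn] at h
    rw [map_list_prod, List.map_ofFn]
    exact h
  have hdet : ∏ q : Fin p, c q = ∑ σ : Equiv.Perm (Fin p),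
      ((Equiv.Perm.sign σ : ℤ) : ℂ) * ∏ q, Matrix.diagonal c q (σ q) := by
    -- `detV` takes the entries `(q, σ q)` and `Matrix.det_apply'` the entries `(σ q, q)`, hence the
    -- transpose.
    rw [← Matrix.det_diagonal, ← Matrix.det_transpose, Matrix.det_apply']
    rfl
  change _ = (∏ q, c q) * _
  rw [hdet, detV, map_sum, LinearMap.sum_apply, LinearMap.sum_apply, Finset.sum_mul]
  refine Finset.sum_congr rfl fun σ _ => ?_
  rw [map_smul, LinearMap.smul_apply, LinearMap.smul_apply, hσ, smul_eq_mul, mul_assoc]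

theorem uDualAction_detV_pow (r : ℂ) (ν : ℕ)
    (ξ : Module.Dual ℂ (MvPolynomial (Sym2 (Fin d × ℤ)) ℂ)) :
    uDualAction d r (detV d r p ^ ν) ξ (traceExp d p (ν * p)) =
      (∏ q : Fin p, (2 * ((q : ℂ) + 1) ^ 2)) ^ ν * ξ (traceExp d p 0) := by
  induction ν with
  | zero => simp
  | succ ν ih =>
    rw [pow_succ', map_mul, Module.End.mul_apply, Nat.succ_mul, uDualAction_detV, ih, pow_succ',
      mul_assoc]

/-- Every term has a first factor, a derivation, which kills constants. For `p = 0` the determinant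
would be `1`. -/
theorem uDualAction_detV_one (r : ℂ) (hp : 1 ≤ p)
    (ξ : Module.Dual ℂ (MvPolynomial (Sym2 (Fin d × ℤ)) ℂ)) :
    uDualAction d r (detV d r p) ξ (traceExp d p 0) = 0 := by
  rw [detV, map_sum, LinearMap.sum_apply, LinearMap.sum_apply]
  refine Finset.sum_eq_zero fun σ _ => ?_
  obtain ⟨p, rfl⟩ := Nat.exists_eq_add_of_le' hp
  rw [map_smul, LinearMap.smul_apply, LinearMap.smul_apply, List.ofFn_succ, List.prod_cons,
    map_mul, Module.End.mul_apply, uDualAction_traceExp_zero, smul_zero]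

theorem traceExp_zero : traceExp d p 0 = 1 := by
  simp [traceExp]

/-- The corresponding functional takes the value `∏ (2 (q + 1) ^ 2) ^ ν` at the divided power of
degree `ν * p`. -/
theorem detV_pow_vac_ne_zero (r : ℂ) (ν : ℕ) : detV d r p ^ ν • vac d r ≠ 0 := by
  obtain ⟨Ψ, hΨ, hvac⟩ := exists_toDual d r
  intro h
  have h1 := uDualAction_detV_pow (p := p) r ν (constFun d)
  have h0 : uDualAction d r (detV d r p ^ ν) (constFun d) = 0 := by
    rw [← hvac, ← hΨ, h, map_zero]
  rw [h0, LinearMap.zero_apply, traceExp_zero, ← map_one MvPolynomial.C, constFun_C, mul_one] at h1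
  refine pow_ne_zero ν (Finset.prod_ne_zero_iff.mpr fun q _ => ?_) h1.symm
  exact mul_ne_zero two_ne_zero (pow_ne_zero 2 (Nat.cast_add_one_ne_zero (q : ℕ)))

end NonVanishing

/-! ### The action of the quadratic elements on `M_r` -/

/-- The operator by which `v^{ij}(m,n)` acts on `M_r`. -/
def opP {d : ℕ} (r : ℂ) (a b : Fin d × ℤ) : Module.End ℂ (Mr d r) :=
  LieModule.toEnd ℂ (Lr d r) (Mr d r) (pairL r a b)

theorem lie_vac_of_plus {d : ℕ} {r : ℂ} (x : LrPlus d r) :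
    ⁅(x : Lr d r), vac d r⁆ = vacChar d r x • vac d r := by
  have h : ((1 : ULr d r) * uIncl (LrPlus d r) (UniversalEnvelopingAlgebra.ι ℂ x)) ⊗ₜ[ℂ] (1 : ℂ) -
      (1 : ULr d r) ⊗ₜ[ℂ] (uVacChar d r (UniversalEnvelopingAlgebra.ι ℂ x) * 1) ∈ indRel d r :=
    Submodule.subset_span ⟨1, _, 1, rfl⟩
  rw [one_mul, mul_one, uIncl_ι, uVacChar, UniversalEnvelopingAlgebra.lift_ι_apply] at h
  have e : ∀ w w' : ULr d r ⊗[ℂ] ℂ, w - w' ∈ indRel d r →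
      (indRel d r).mkQ w = (indRel d r).mkQ w' := fun w w' h => by
    rw [Submodule.mkQ_apply, Submodule.mkQ_apply]
    exact (Submodule.Quotient.eq _).mpr h
  have h1 := e _ _ h
  have h2 : ⁅(x : Lr d r), vac d r⁆ =
      (indRel d r).mkQ (UniversalEnvelopingAlgebra.ι ℂ (x : Lr d r) ⊗ₜ[ℂ] (1 : ℂ)) := by
    rw [Mr.lie_def, vac]
    refine ((indRel d r).mkQ.map_smul _ _).symm.trans ?_
    rw [TensorProduct.smul_tmul', smul_eq_mul, mul_one]
  have h3 : vacChar d r x • vac d r =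
      (indRel d r).mkQ ((1 : ULr d r) ⊗ₜ[ℂ] (vacChar d r x)) := by
    have : (1 : ULr d r) ⊗ₜ[ℂ] (vacChar d r x) =
        algebraMap ℂ (ULr d r) (vacChar d r x) • ((1 : ULr d r) ⊗ₜ[ℂ] (1 : ℂ)) := by
      rw [algebraMap_smul, ← TensorProduct.tmul_smul, smul_eq_mul, mul_one]
    rw [this]
    refine Eq.trans ?_ ((indRel d r).mkQ.map_smul _ _).symm
    exact (algebraMap_smul (ULr d r) (vacChar d r x) (vac d r)).symm
  rw [h2, h3]
  exact h1

theorem opP_vac {d : ℕ} (r : ℂ) (a b : Fin d × ℤ) (h : a.1 < b.1 ∨ a.1 = b.1 ∧ a.2 ≤ b.2)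
    (h' : 0 ≤ a.2 ∨ 0 ≤ b.2) : opP r a b (vac d r) = 0 := by
  have h2 := lie_vac_of_plus (⟨pairL r a b, quad_mem_plus _ _ _ _ h'⟩ : LrPlus d r)
  rw [vacChar_apply, pi2_eq_vacExp] at h2
  have h3 : vacExp d (quad a.1 b.1 a.2 b.2) = 0 := by rw [vacExp_quad, vacForm_eq_zero h]
  exact h2.trans (by rw [toL_pairL, h3, zero_smul])

theorem Mr_induction {d : ℕ} {r : ℂ} (w : Mr d r) : ∃ u : ULr d r, w = u • vac d r := by
  obtain ⟨t, rfl⟩ := (indRel d r).mkQ_surjective w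
  induction t using TensorProduct.induction_on with
  | zero => exact ⟨0, by rw [zero_smul, map_zero]; rfl⟩
  | tmul u z =>
    refine ⟨z • u, ?_⟩
    have : u ⊗ₜ[ℂ] z = (z • u) • ((1 : ULr d r) ⊗ₜ[ℂ] (1 : ℂ)) := by
      rw [TensorProduct.smul_tmul', smul_eq_mul, mul_one, TensorProduct.smul_tmul, smul_eq_mul,
        mul_one]
    rw [this]
    exact (indRel d r).mkQ.map_smul _ _
  | add x y hx hy =>
    obtain ⟨u, hu⟩ := hx
    obtain ⟨u', hu'⟩ := hy
    refine ⟨u + u', ?_⟩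
    rw [map_add, add_smul, hu, hu']
    rfl

/-- The element `1` of `𝓛_r` is central and fixes the vacuum, which generates `M_r`. -/
theorem lie_oneLr {d : ℕ} {r : ℂ} (w : Mr d r) : ⁅oneLr d r, w⁆ = w := by
  have hvac : ⁅oneLr d r, vac d r⁆ = vac d r := by
    have h := lie_vac_of_plus (⟨oneLr d r, Submodule.mem_sup_right
      (Submodule.mem_span_singleton_self _)⟩ : LrPlus d r)
    have h1 : vacChar d r ⟨oneLr d r, Submodule.mem_sup_right
        (Submodule.mem_span_singleton_self _)⟩ = 1 := by
      rw [vacChar_apply, pi2_eq_vacExp]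
      exact vacExp_one d
    rw [h1, one_smul] at h
    exact h
  obtain ⟨u, rfl⟩ := Mr_induction w
  let S : Subalgebra ℂ (ULr d r) :=
    Subalgebra.centralizer ℂ {UniversalEnvelopingAlgebra.ι ℂ (oneLr d r)}
  have hu : u ∈ S := by
    refine universalEnveloping_mem S (fun x => ?_) u
    rw [Subalgebra.mem_centralizer_iff]
    rintro _ rfl
    rw [← sub_eq_zero, ← LieRing.of_associative_ring_bracket, ← LieHom.map_lie, oneLr_lie, map_zero]
  have h := (Subalgebra.mem_centralizer_iff ℂ).mp hu _ rfl
  rw [Mr.lie_def, ← mul_smul, h, mul_smul]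
  exact congrArg (fun w => u • w) hvac

theorem toEnd_oneLr (d : ℕ) (r : ℂ) :
    LieModule.toEnd ℂ (Lr d r) (Mr d r) (oneLr d r) = 1 :=
  LinearMap.ext fun w => lie_oneLr w

theorem opP_swap {d : ℕ} (r : ℂ) (a b : Fin d × ℤ) :
    opP r a b = opP r b a + contrP a b • 1 := by
  rw [opP, pairL_swap, map_add, map_smul, toEnd_oneLr]
  rfl

theorem opP_comm {d : ℕ} (r : ℂ) (a b c e : Fin d × ℤ) :
    opP r a b * opP r c e = opP r c e * opP r a b +
      (contrP b c • opP r a e + contrP a c • opP r b e + contrP b e • opP r c a +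
        contrP a e • opP r c b +
      ((r - 1) * (contrP b c * vacForm a e + contrP a c * vacForm b e + contrP b e * vacForm c a +
        contrP a e * vacForm c b)) • 1) := by
  have h := congrArg (LieModule.toEnd ℂ (Lr d r) (Mr d r)) (lie_pairL r a b c e)
  simp only [LieHom.map_lie, map_add, map_smul, toEnd_oneLr, LieRing.of_associative_ring_bracket]
    at h
  exact sub_eq_iff_eq_add'.mp h

theorem contrP_of_fst_ne {d : ℕ} {a b : Fin d × ℤ} (h : a.1 ≠ b.1) : contrP a b = 0 :=
  if_neg fun h' => h h'.1

theorem vacForm_of_contrP {d : ℕ} {a b : Fin d × ℤ} (h : contrP a b = 0) : vacForm a b = 0 := by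
  rw [vacForm]
  split_ifs
  exacts [h, rfl]

/-! ### The operators `v(m,n)` on polynomials in the lowering operators. -/

section RankOne

variable {d : ℕ} [NeZero d] (r : ℂ)

/-- The operator by which `v(m,n)` acts on `M_r`. -/
def opV (m n : ℤ) : Module.End ℂ (Mr d r) := opP r ((0 : Fin d), m) ((0 : Fin d), n)

theorem opV_def (m n : ℤ) : opV r m n = opP r ((0 : Fin d), m) ((0 : Fin d), n) := rfl

theorem contrP_zero (m n : ℤ) : contrP ((0 : Fin d), m) ((0 : Fin d), n) =
    if m + n = 0 then (m : ℂ) else 0 := by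
  rw [contrP, contr]
  simp

theorem contrP_zero_of_ne {m n : ℤ} (h : m + n ≠ 0) :
    contrP ((0 : Fin d), m) ((0 : Fin d), n) = 0 := by
  rw [contrP_zero, if_neg h]

theorem contrP_zero_left (n : ℤ) : contrP ((0 : Fin d), 0) ((0 : Fin d), n) = 0 := by
  rw [contrP_zero, Int.cast_zero, ite_self]

theorem opV_swap {m n : ℤ} (h : m + n ≠ 0) : opV (d := d) r m n = opV r n m := by
  rw [opV, opP_swap, contrP_zero_of_ne h, zero_smul, add_zero]
  rfl

theorem opV_vac {m n : ℤ} (h : 0 ≤ n) : opV r m n (vac d r) = 0 := by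
  by_cases hmn : m ≤ n
  · exact opP_vac r _ _ (Or.inr ⟨rfl, hmn⟩) (Or.inr h)
  · rw [opV_swap r (by omega)]
    exact opP_vac r _ _ (Or.inr ⟨rfl, by dsimp only; omega⟩) (Or.inl h)

theorem opV_comm_of_neg (m n : ℤ) {s : ℤ} (t : ℤ) (hs : s < 0) :
    opV (d := d) r m n * opV r s t = opV r s t * opV r m n +
      (contrP ((0 : Fin d), n) ((0 : Fin d), s) • opV r m t +
        contrP ((0 : Fin d), m) ((0 : Fin d), s) • opV r n t +
        contrP ((0 : Fin d), n) ((0 : Fin d), t) • opV r s m +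
        contrP ((0 : Fin d), m) ((0 : Fin d), t) • opV r s n +
      ((r - 1) * (contrP ((0 : Fin d), n) ((0 : Fin d), s) * vacForm ((0 : Fin d), m) (0, t) +
        contrP ((0 : Fin d), m) ((0 : Fin d), s) * vacForm ((0 : Fin d), n) (0, t))) • 1) := by
  rw [opV, opV, opP_comm, vacForm_of_nonpos_left ((0 : Fin d), m) hs.le,
    vacForm_of_nonpos_left ((0 : Fin d), n) hs.le, mul_zero, mul_zero, add_zero, add_zero]
  rfl

theorem opV_lowering_commute {m n s t : ℤ} (hm : m < 0) (hn : n < 0) (hs : s < 0) (ht : t < 0) :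
    opV (d := d) r m n * opV r s t = opV r s t * opV r m n := by
  rw [opV_comm_of_neg r m n t hs, contrP_zero_of_ne (by omega), contrP_zero_of_ne (by omega),
    contrP_zero_of_ne (by omega), contrP_zero_of_ne (by omega)]
  simp

variable (d) (p : ℕ)

/-- The index `i : Fin p` stands for the mode `-(i + 1)`. The variables `(i,j)` and `(j,i)` have the
same image, so identities for the generic matrix apply without a symmetric version. -/
theorem exists_lowering :
    ∃ φ : MvPolynomial (Fin p × Fin p) ℂ →ₐ[ℂ] Module.End ℂ (Mr d r),
      ∀ i j, φ (genMat (Fin p) i j) = opV r (-((i : ℤ) + 1)) (-((j : ℤ) + 1)) := by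
  obtain ⟨φ, hφ⟩ := exists_aeval_of_commute
    (fun c : Fin p × Fin p => opV (d := d) r (-((c.1 : ℤ) + 1)) (-((c.2 : ℤ) + 1)))
    (fun i j => opV_lowering_commute r (by omega) (by omega) (by omega) (by omega))
  exact ⟨φ, fun i j => hφ (i, j)⟩

/-- The homomorphism which sends the variables to the operators `v(-s,-t)`. -/
def lowering : MvPolynomial (Fin p × Fin p) ℂ →ₐ[ℂ] Module.End ℂ (Mr d r) :=
  (exists_lowering d r p).choose

variable {d p}

theorem lowering_genMat (i j : Fin p) :
    lowering d r p (genMat (Fin p) i j) = opV r (-((i : ℤ) + 1)) (-((j : ℤ) + 1)) :=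
  (exists_lowering d r p).choose_spec i j

theorem detV_pow_smul (ν : ℕ) (w : Mr d r) :
    detV d r p ^ ν • w = lowering d r p ((genMat (Fin p)).det ^ ν) w := by
  let A : ULr d r →ₐ[ℂ] Module.End ℂ (Mr d r) := Algebra.lsmul ℂ ℂ (Mr d r)
  have hA : ∀ x : Lr d r, A (UniversalEnvelopingAlgebra.ι ℂ x) =
      LieModule.toEnd ℂ (Lr d r) (Mr d r) x := fun x => rfl
  have h : A (detV d r p) = lowering d r p (genMat (Fin p)).det := by
    rw [← Matrix.det_transpose, Matrix.det_apply, detV, map_sum, map_sum]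
    refine Finset.sum_congr rfl fun σ _ => ?_
    rw [map_smul, Units.smul_def, map_zsmul, ← Int.cast_smul_eq_zsmul ℂ, ← List.prod_ofFn,
      map_list_prod, map_list_prod, List.map_ofFn, List.map_ofFn]
    congr 3
    funext q
    exact (lowering_genMat r q (σ q)).symm
  change A (detV d r p ^ ν) w = _
  rw [map_pow, h, map_pow]

/-- An operator which kills `𝟏`, and whose commutators with the `v(-s,-t)` kill all the
polynomials in them, kills all these polynomials as well. -/
theorem kill_lowering (Y : Module.End ℂ (Mr d r)) (hY : Y (vac d r) = 0)
    (h : ∀ i j : Fin p, ∃ D : Module.End ℂ (Mr d r),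
      Y * opV r (-((i : ℤ) + 1)) (-((j : ℤ) + 1)) =
        opV r (-((i : ℤ) + 1)) (-((j : ℤ) + 1)) * Y + D ∧
      ∀ s, D (lowering d r p s (vac d r)) = 0) (s : MvPolynomial (Fin p × Fin p) ℂ) :
    Y (lowering d r p s (vac d r)) = 0 := by
  induction s using MvPolynomial.induction_on with
  | C z =>
    rw [← MvPolynomial.algebraMap_eq, AlgHom.commutes, Module.algebraMap_end_apply, map_smul, hY,
      smul_zero]
  | add f g hf hg => rw [map_add, LinearMap.add_apply, map_add, hf, hg, add_zero]
  | mul_X f c hf =>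
    obtain ⟨D, hD, hD0⟩ := h c.1 c.2
    rw [← lowering_genMat] at hD
    have := congrArg (fun F : Module.End ℂ (Mr d r) => F (lowering d r p f (vac d r))) hD
    simp only [LinearMap.add_apply, Module.End.mul_apply, hf, hD0, map_zero, add_zero] at this
    rw [mul_comm, map_mul, Module.End.mul_apply]
    exact this

/-- Neither mode can be contracted with a mode between `-p` and `-1`, so the operator commutes with
the lowering operators. -/
theorem opV_kill_of_neg_of_gt {s n : ℤ} (hs : s < 0) (hn : (p : ℤ) < n)
    (f : MvPolynomial (Fin p × Fin p) ℂ) : opV r s n (lowering d r p f (vac d r)) = 0 := by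
  refine kill_lowering r _ (opV_vac r (by omega)) (fun i j => ⟨0, ?_, fun _ => rfl⟩) f
  rw [opV_comm_of_neg r s n _ (by omega), contrP_zero_of_ne (by omega),
    contrP_zero_of_ne (by omega), contrP_zero_of_ne (by omega), contrP_zero_of_ne (by omega)]
  simp

/-- The mode `0` is central in the Heisenberg algebra, so it has no contractions. -/
theorem opV_kill_zero {s : ℤ} (hs : s < 0) (f : MvPolynomial (Fin p × Fin p) ℂ) :
    opV r s 0 (lowering d r p f (vac d r)) = 0 := by
  refine kill_lowering r _ (opV_vac r le_rfl) (fun i j => ⟨0, ?_, fun _ => rfl⟩) f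
  rw [opV_comm_of_neg r s 0 _ (by omega), contrP_zero_left, contrP_zero_left,
    contrP_zero_of_ne (by omega), contrP_zero_of_ne (by omega)]
  simp

/-- Only `m` can be contracted, and this leaves operators `v(s,n)` with `s < 0`, which are covered
by `opV_kill_of_neg_of_gt`. -/
theorem opV_kill_of_gt {m n : ℤ} (hn : (p : ℤ) < n)
    (f : MvPolynomial (Fin p × Fin p) ℂ) : opV r m n (lowering d r p f (vac d r)) = 0 := by
  refine kill_lowering r _ (opV_vac r (by omega)) (fun i j =>
    ⟨_, opV_comm_of_neg r m n _ (by omega), fun f => ?_⟩) f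
  have h0 : vacForm ((0 : Fin d), n) ((0 : Fin d), -((j : ℤ) + 1)) = 0 :=
    vacForm_of_contrP (contrP_zero_of_ne (by omega))
  rw [contrP_zero_of_ne (by omega : n + -((i : ℤ) + 1) ≠ 0),
    contrP_zero_of_ne (by omega : n + -((j : ℤ) + 1) ≠ 0), h0, opV_swap r (m := n) (by omega)]
  simp [-neg_add_rev, opV_kill_of_neg_of_gt r (by omega : -((i : ℤ) + 1) < 0) hn,
    opV_kill_of_neg_of_gt r (by omega : -((j : ℤ) + 1) < 0) hn]

theorem opV_kill_zero_of_pos {n : ℤ} (hn : 0 < n)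
    (f : MvPolynomial (Fin p × Fin p) ℂ) : opV r 0 n (lowering d r p f (vac d r)) = 0 := by
  refine kill_lowering r _ (opV_vac r hn.le) (fun i j =>
    ⟨_, opV_comm_of_neg r 0 n _ (by omega), fun f => ?_⟩) f
  rw [contrP_zero_left, contrP_zero_left, vacForm_of_nonpos_left _ le_rfl,
    opV_swap r (m := 0) (by omega)]
  simp [-neg_add_rev, opV_kill_zero r (by omega : -((i : ℤ) + 1) < 0),
    opV_kill_zero r (by omega : -((j : ℤ) + 1) < 0)]

theorem contrP_pos_neg (k i : Fin p) :
    contrP ((0 : Fin d), (k : ℤ) + 1) ((0 : Fin d), -((i : ℤ) + 1)) =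
      if i = k then (k : ℂ) + 1 else 0 := by
  rw [contrP_zero]
  by_cases h : i = k
  · rw [if_pos h, if_pos (by rw [h]; omega)]
    push_cast
    rfl
  · rw [if_neg h, if_neg fun h' => h (Fin.ext (by omega))]

/-- The operators `v(-t,k)` act on polynomials in the `v(-i,-j)` by a derivation. -/
theorem opV_lowering (k t : Fin p) (i j : Fin p) :
    opV (d := d) r (-((t : ℤ) + 1)) ((k : ℤ) + 1) * lowering d r p (genMat (Fin p) i j) =
      lowering d r p (genMat (Fin p) i j) * opV r (-((t : ℤ) + 1)) ((k : ℤ) + 1) +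
        lowering d r p (replaceDer ((k : ℂ) + 1) k t (genMat (Fin p) i j)) := by
  rw [replaceDer_genMat, map_smul, map_add, lowering_genMat,
    opV_comm_of_neg r _ _ _ (by omega),
    contrP_zero_of_ne (by omega : -((t : ℤ) + 1) + -((i : ℤ) + 1) ≠ 0),
    contrP_zero_of_ne (by omega : -((t : ℤ) + 1) + -((j : ℤ) + 1) ≠ 0),
    vacForm_of_nonpos_left _ (by dsimp only; omega), contrP_pos_neg, contrP_pos_neg]
  congr 1
  by_cases hi : i = k <;> by_cases hj : j = k <;> simp [hi, hj, lowering_genMat]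

theorem opV_diag_kill (k : Fin p) (ν : ℕ) (hν : 1 ≤ ν) (h : r - p + 2 * ν - 1 = 0) :
    opV r ((k : ℤ) + 1) ((k : ℤ) + 1)
      (lowering d r p ((genMat (Fin p)).det ^ ν) (vac d r)) = 0 := by
  have key := annihilate_det_pow (lowering d r p) ((k : ℂ) + 1) r k
    (fun t => opV r (-((t : ℤ) + 1)) ((k : ℤ) + 1)) (opV r ((k : ℤ) + 1) ((k : ℤ) + 1)) (vac d r)
    (fun t i j => opV_lowering r k t i j) ?_ ?_ ?_ (fun t => opV_vac r (by omega))
    (opV_vac r (by omega)) ν hν (by rw [Fintype.card_fin]; exact h)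
  · rw [map_pow]
    exact key
  · intro i j hi hj
    rw [lowering_genMat, opV_comm_of_neg r _ _ _ (by omega), contrP_pos_neg,
      contrP_pos_neg, if_neg hi, if_neg hj]
    simp
  · intro i hi
    rw [lowering_genMat, opV_comm_of_neg r _ _ _ (by omega), contrP_pos_neg,
      contrP_pos_neg, if_neg hi, if_pos rfl]
    simp only [zero_smul, zero_mul, mul_zero, add_zero, zero_add, two_mul, add_smul]
  · intro j
    rw [lowering_genMat, opV_comm_of_neg r _ _ _ (by omega), contrP_pos_neg,
      contrP_pos_neg, if_pos rfl, vacForm_pos_neg]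
    -- Moving the positive mode to the right in `v(k,-j)` yields a scalar for `j = k`; it turns the
    -- central coefficient `r - 1` of the bracket into `r`.
    have hsw := opP_swap r ((0 : Fin d), (k : ℤ) + 1) ((0 : Fin d), -((j : ℤ) + 1))
    rw [contrP_pos_neg] at hsw
    change opV r _ _ = opV r _ _ + _ at hsw
    rw [hsw]
    congr 1
    by_cases hj : j = k
    · subst hj
      simp only [if_true, Algebra.algebraMap_eq_smul_one]
      module
    · rw [if_neg hj, if_neg hj, if_neg (Ne.symm hj)]
      simp only [zero_smul, mul_zero, add_zero]
      module

/-- `v(-t,k)` kills the vacuum, so only the derivation of `replaceDer_det` remains, applied to a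
power. -/
theorem opV_det_pow (k t : Fin p) (ν : ℕ) :
    opV r (-((t : ℤ) + 1)) ((k : ℤ) + 1)
      (lowering d r p ((genMat (Fin p)).det ^ ν) (vac d r)) =
    (if t = k then 2 * (ν : ℂ) * ((k : ℂ) + 1) else 0) •
      lowering d r p ((genMat (Fin p)).det ^ ν) (vac d r) := by
  have h := replaceDer_spec (lowering d r p) ((k : ℂ) + 1) k t _ (opV_lowering r k t)
    ((genMat (Fin p)).det ^ ν)
  have h' := congrArg (fun F : Module.End ℂ (Mr d r) => F (vac d r)) h
  simp only [LinearMap.add_apply, Module.End.mul_apply, opV_vac r (by omega : 0 ≤ (k : ℤ) + 1),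
    map_zero, zero_add] at h'
  rw [h', Derivation.leibniz_pow, replaceDer_det]
  split_ifs
  · rcases ν with _ | ν
    · simp
    · rw [Nat.add_sub_cancel, smul_comm _ (2 * ((k : ℂ) + 1)), smul_eq_mul, ← pow_succ,
        ← Nat.cast_smul_eq_nsmul ℂ, smul_smul, map_smul, LinearMap.smul_apply]
      congr 1
      ring
  · simp

/-- With `m ≤ n ≤ p`, a negative `m` gives an off-diagonal derivation and `m = n` is
`opV_diag_kill`. For `0 < m < n` the operator is `-1 / (2 n)` times the commutator of `v(-n,m)` and
`v(n,n)`, both of which kill the vector. -/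
theorem opV_kill_det_pow (ν : ℕ) (hν : 1 ≤ ν) (h : r - p + 2 * ν - 1 = 0) (m n : ℤ)
    (hmn : 0 < m + n) :
    opV r m n (lowering d r p ((genMat (Fin p)).det ^ ν) (vac d r)) = 0 := by
  wlog hle : m ≤ n generalizing m n
  · rw [opV_swap r (by omega)]
    exact this n m (by omega) (by omega)
  have hoff : ∀ k t : Fin p, t ≠ k → opV r (-((t : ℤ) + 1)) ((k : ℤ) + 1)
      (lowering d r p ((genMat (Fin p)).det ^ ν) (vac d r)) = 0 := by
    intro k t hkt
    rw [opV_det_pow, if_neg hkt, zero_smul]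
  have hidx : ∀ a : ℤ, 0 < a → a ≤ p → ∃ k : Fin p, (k : ℤ) + 1 = a := by
    intro a h0 hp
    exact ⟨⟨(a - 1).toNat, by omega⟩, by dsimp only; omega⟩
  by_cases hp : (p : ℤ) < n
  · exact opV_kill_of_gt r hp _
  obtain ⟨k, hk⟩ := hidx n (by omega) (by omega)
  rcases lt_trichotomy m 0 with hm | rfl | hm
  · obtain ⟨t, ht⟩ := hidx (-m) (by omega) (by omega)
    have := hoff k t (by rintro rfl; omega)
    rwa [hk, ht, neg_neg] at this
  · exact opV_kill_zero_of_pos r (by omega) _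
  · obtain ⟨t, ht⟩ := hidx m hm (by omega)
    by_cases htk : t = k
    · have := opV_diag_kill (d := d) r k ν hν h
      rwa [← hk, ← ht, htk]
    · have h1 := hoff t k (Ne.symm htk)
      have h2 := opV_diag_kill (d := d) r k ν hν h
      rw [hk, ht] at h1
      rw [hk] at h2
      have hne : m ≠ n := fun h' => htk (Fin.ext (by omega))
      have h3 := congrArg (fun F : Module.End ℂ (Mr d r) =>
        F (lowering d r p ((genMat (Fin p)).det ^ ν) (vac d r)))
        (opP_comm r ((0 : Fin d), -n) ((0 : Fin d), m) ((0 : Fin d), n) ((0 : Fin d), n))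
      have h4 : vacForm ((0 : Fin d), n) ((0 : Fin d), m) = 0 :=
        vacForm_of_contrP (contrP_zero_of_ne (by omega))
      have h5 : vacForm ((0 : Fin d), m) ((0 : Fin d), n) = 0 :=
        vacForm_of_contrP (contrP_zero_of_ne (by omega))
      rw [contrP_zero_of_ne (by omega : m + n ≠ 0), h4, h5, contrP_zero, if_pos (by omega)] at h3
      simp only [← opV_def] at h3
      rw [opV_swap r (m := n) (n := m) (by omega)] at h3
      simp only [LinearMap.add_apply, Module.End.mul_apply, h1, h2, map_zero, zero_add, zero_smul,
        mul_zero, add_zero, LinearMap.smul_apply, zero_mul] at h3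
      rw [← add_smul] at h3
      refine (smul_eq_zero.mp h3.symm).resolve_left ?_
      have : (n : ℂ) ≠ 0 := Int.cast_ne_zero.mpr (by omega)
      intro h'
      apply this
      push_cast at h'
      linear_combination -h' / 2

end RankOne

/-! ### Weight, membership in `M_r^{(1)}`, and singularity. -/

section Singular

variable {d : ℕ} [NeZero d] (r : ℂ) {p : ℕ}

theorem opP_kill_of_ne (k : Fin d) (hk : k ≠ 0) {l : ℤ} (hl : l < 0)
    (f : MvPolynomial (Fin p × Fin p) ℂ) :
    opP r (k, l) (k, -l) (lowering d r p f (vac d r)) = 0 := by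
  have hvac : opP r (k, l) (k, -l) (vac d r) = 0 :=
    opP_vac r (k, l) (k, -l) (Or.inr ⟨rfl, by dsimp only; omega⟩) (Or.inr (by dsimp only; omega))
  refine kill_lowering r _ hvac (fun i j => ⟨0, ?_, fun _ => rfl⟩) f
  have hz : ∀ m n : ℤ, contrP (k, m) ((0 : Fin d), n) = 0 := fun m n =>
    contrP_of_fst_ne (a := (k, m)) (b := ((0 : Fin d), n)) hk
  rw [opV, opP_comm, hz, hz, hz, hz]
  simp

/-- The weight of `(det V_p)^ν 𝟏`. -/
def detWeight (p ν : ℕ) : {l : ℤ // l < 0} →₀ ℕ :=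
  Finsupp.onFinset ((Finset.Icc (-(p : ℤ)) (-1)).subtype fun l => l < 0)
    (fun l => if -(p : ℤ) ≤ l then 2 * ν else 0) (by
      intro l hl
      rw [Finset.mem_subtype, Finset.mem_Icc]
      have := l.2
      exact ⟨by by_contra h; exact hl (if_neg h), by omega⟩)

theorem detWeight_apply (p ν : ℕ) (l : {l : ℤ // l < 0}) :
    detWeight p ν l = if -(p : ℤ) ≤ l then 2 * ν else 0 := rfl

theorem detWeight_ne_zero {p ν : ℕ} (hp : 1 ≤ p) (hν : 1 ≤ ν) : detWeight p ν ≠ 0 := by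
  intro h
  have := congrArg (fun F : {l : ℤ // l < 0} →₀ ℕ => F ⟨-1, by omega⟩) h
  simp only [detWeight_apply, Finsupp.coe_zero, Pi.zero_apply] at this
  rw [if_pos (by omega)] at this
  omega

/-- Each mode `-1, …, -p` occurs twice in every term of the determinant, once as a row and once as a
column index, hence the weight `2 ν`. The `h_{k,l}` of the other components commute with all
`v(-s,-t)`. -/
theorem hasWeight_det_pow (ν : ℕ) :
    HasWeight1 (detWeight p ν) (lowering d r p ((genMat (Fin p)).det ^ ν) (vac d r)) := by
  rintro k ⟨l, hl⟩
  have e : ⁅hkl r k l, lowering d r p ((genMat (Fin p)).det ^ ν) (vac d r)⁆ =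
      (-(1 / (l : ℂ))) • opP r (k, l) (k, -l)
        (lowering d r p ((genMat (Fin p)).det ^ ν) (vac d r)) := by
    rw [hkl, smul_lie]
    rfl
  rw [e]
  by_cases hk : k = 0
  · subst hk
    rw [if_pos rfl, detWeight_apply, ← opV_def]
    dsimp only
    by_cases hlp : -(p : ℤ) ≤ l
    · obtain ⟨q, hq⟩ : ∃ q : Fin p, (q : ℤ) + 1 = -l :=
        ⟨⟨(-l - 1).toNat, by omega⟩, by dsimp only; omega⟩
      have h := opV_det_pow (d := d) r q q ν
      have hlC : (l : ℂ) = -((q : ℂ) + 1) := by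
        rw [show l = -((q : ℤ) + 1) by omega]
        push_cast
        rfl
      have h0 : (q : ℂ) + 1 ≠ 0 := Nat.cast_add_one_ne_zero _
      rw [hq, neg_neg, if_pos rfl] at h
      rw [if_pos hlp, h, smul_smul, hlC]
      congr 1
      push_cast
      field_simp
    · rw [if_neg hlp, opV_kill_of_gt r (by omega), smul_zero, Nat.cast_zero, zero_smul]
  · rw [if_neg hk, zero_smul, opP_kill_of_ne r k hk hl, smul_zero]

/-- The excluded case is `m > n`, `m + n = 0`, where `v(m,n)` differs from the generator `v(n,m)` by
a nonzero scalar. -/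
theorem v_mem_Lr1 (m n : ℤ) (h : m ≤ n ∨ m + n ≠ 0) : v (d := d) r m n ∈ Lr1 d r := by
  by_cases hmn : m ≤ n
  · exact LieSubalgebra.subset_lieSpan ⟨m, n, hmn, rfl⟩
  · have : v (d := d) r m n = v r n m := by
      have h1 := pairL_swap r ((0 : Fin d), m) ((0 : Fin d), n)
      rw [contrP_zero_of_ne (h.resolve_left hmn), zero_smul, add_zero] at h1
      exact h1
    rw [this]
    exact LieSubalgebra.subset_lieSpan ⟨n, m, by omega, rfl⟩

theorem vac_mem_Mr1 : vac d r ∈ Mr1 d r := ⟨1, by rw [map_one, one_smul]⟩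

theorem detV_pow_vac_mem (ν : ℕ) : detV d r p ^ ν • vac d r ∈ Mr1 d r := by
  have h : detV d r p ∈ (uIncl (Lr1 d r)).range := by
    refine sum_mem fun σ _ => Subalgebra.smul_mem _ (list_prod_mem fun x hx => ?_) _
    obtain ⟨q, rfl⟩ := List.mem_ofFn.mp hx
    exact ⟨UniversalEnvelopingAlgebra.ι ℂ ⟨_, v_mem_Lr1 r _ _ (Or.inr (by omega))⟩, uIncl_ι _ _⟩
  obtain ⟨a, ha⟩ := pow_mem h ν
  exact ⟨a, by rw [← ha]; rfl⟩

theorem isSingular_detV_pow (ν : ℕ) (hp : 1 ≤ p) (hν : 1 ≤ ν) (h : r - p + 2 * ν - 1 = 0) :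
    IsSingular (detV d r p ^ ν • vac d r) := by
  refine ⟨detV_pow_vac_mem r ν, detV_pow_vac_ne_zero r ν, ⟨detWeight p ν, detWeight_ne_zero hp hν,
    ?_⟩, fun m n hmn => ?_⟩
  · rw [detV_pow_smul]
    exact hasWeight_det_pow r ν
  · rw [detV_pow_smul]
    exact opV_kill_det_pow r ν hν h m n hmn

/-! ### The submodule generated by a singular vector -/

/-- The smallest subspace which contains `u` and is stable under the `v(m,n)` with `m + n ≤ 0`. -/
def lowerClosure (u : Mr d r) : Submodule ℂ (Mr d r) :=
  sInf {S | u ∈ S ∧ ∀ m n : ℤ, m + n ≤ 0 → ∀ w ∈ S, opV r m n w ∈ S}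

variable {r}

theorem mem_lowerClosure (u : Mr d r) : u ∈ lowerClosure r u :=
  (Submodule.mem_sInf).mpr fun _ hS => hS.1

theorem opV_mem_lowerClosure_of_nonpos {u w : Mr d r} (hw : w ∈ lowerClosure r u) {m n : ℤ}
    (h : m + n ≤ 0) : opV r m n w ∈ lowerClosure r u :=
  (Submodule.mem_sInf).mpr fun S hS => hS.2 m n h w ((Submodule.mem_sInf).mp hw S hS)

/-- Let `S` consist of the vectors of the closure that every `v(s,t)` maps into the closure. It
contains `u`, which the raising operators kill. It is stable under the `v(m,n)` with `m + n ≤ 0`,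
since commutators of quadratic elements are combinations of quadratic elements and `1`. By
minimality it is the whole closure. -/
theorem opV_mem_lowerClosure {u : Mr d r} (hu : ∀ m n : ℤ, 0 < m + n → opV r m n u = 0)
    {w : Mr d r} (hw : w ∈ lowerClosure r u) (m n : ℤ) : opV r m n w ∈ lowerClosure r u := by
  let S : Submodule ℂ (Mr d r) :=
    lowerClosure r u ⊓ ⨅ c : ℤ × ℤ, (lowerClosure r u).comap (opV r c.1 c.2)
  have hS : ∀ w, w ∈ S ↔ w ∈ lowerClosure r u ∧ ∀ m n, opV r m n w ∈ lowerClosure r u := by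
    intro w
    simp [S, Submodule.mem_iInf]
  have hle : lowerClosure r u ≤ S := by
    refine sInf_le ⟨(hS u).mpr ⟨mem_lowerClosure u, fun m n => ?_⟩, fun m n hmn w hw => ?_⟩
    · by_cases h : m + n ≤ 0
      · exact opV_mem_lowerClosure_of_nonpos (mem_lowerClosure u) h
      · rw [hu m n (by omega)]
        exact zero_mem _
    · rw [hS] at hw ⊢
      refine ⟨hw.2 m n, fun s t => ?_⟩
      have hc := congrArg (fun F : Module.End ℂ (Mr d r) => F w)
        (opP_comm r ((0 : Fin d), s) ((0 : Fin d), t) ((0 : Fin d), m) ((0 : Fin d), n))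
      simp only [← opV_def, LinearMap.add_apply, Module.End.mul_apply, LinearMap.smul_apply,
        Module.End.one_apply] at hc
      rw [hc]
      exact add_mem (opV_mem_lowerClosure_of_nonpos (hw.2 s t) hmn)
        (add_mem (add_mem (add_mem (add_mem (Submodule.smul_mem _ _ (hw.2 _ _))
          (Submodule.smul_mem _ _ (hw.2 _ _))) (Submodule.smul_mem _ _ (hw.2 _ _)))
          (Submodule.smul_mem _ _ (hw.2 _ _))) (Submodule.smul_mem _ _ hw.1))
  exact ((hS w).mp (hle hw)).2 m n

theorem lie_mem_lowerClosure {u : Mr d r} (hu : ∀ m n : ℤ, 0 < m + n → opV r m n u = 0)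
    {x : Lr d r} (hx : x ∈ Lr1 d r) {w : Mr d r} (hw : w ∈ lowerClosure r u) :
    ⁅x, w⁆ ∈ lowerClosure r u := by
  induction hx using LieSubalgebra.lieSpan_induction generalizing w with
  | mem x hx =>
    obtain ⟨m, n, -, rfl⟩ := hx
    exact opV_mem_lowerClosure hu hw m n
  | zero => rw [zero_lie]; exact zero_mem _
  | add x y _ _ hx hy => rw [add_lie]; exact add_mem (hx hw) (hy hw)
  | smul t x _ hx => rw [smul_lie]; exact Submodule.smul_mem _ _ (hx hw)
  | lie x y _ _ hx hy => rw [lie_lie]; exact sub_mem (hx (hy hw)) (hy (hx hw))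

/-- One of the modes is nonpositive, so `symVar` vanishes and the operator sends `1` to a scalar.
This scalar can be nonzero when `m + n = 0`, hence the hypothesis on `ξ`. -/
theorem uDualAction_v_one (ξ : Module.Dual ℂ (MvPolynomial (Sym2 (Fin d × ℤ)) ℂ)) {m n : ℤ}
    (h : m + n ≤ 0) (hξ : ξ 1 = 0) :
    uDualAction d r (UniversalEnvelopingAlgebra.ι ℂ (v r m n)) ξ 1 = 0 := by
  rw [uDualAction_ι, dualAction_apply, rightAction_v, pairOp_apply,
    symVar_of_not_pos (by dsimp only; omega), Derivation.map_one_eq_zero, mul_zero, zero_add,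
    zero_add, ← MvPolynomial.smul_eq_C_mul, map_smul, hξ, smul_zero]

/-- The operators `v(m,n)` with `m + n ≤ 0` preserve the functionals that vanish at `1`, and the
vacuum functional does not vanish there. -/
theorem vac_not_mem_lowerClosure (ν : ℕ) (hp : 1 ≤ p) (hν : 1 ≤ ν) :
    vac d r ∉ lowerClosure r (detV d r p ^ ν • vac d r) := by
  obtain ⟨Ψ, hΨ, hvac⟩ := exists_toDual d r
  have hsmul : ∀ (z : ℂ) w, Ψ (z • w) = z • Ψ w := by
    intro z w
    rw [← algebraMap_smul (ULr d r) z w, hΨ, AlgHom.commutes]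
    rfl
  let S : Submodule ℂ (Mr d r) :=
    { carrier := {w | Ψ w 1 = 0}
      zero_mem' := by
        change Ψ 0 1 = 0
        rw [map_zero, LinearMap.zero_apply]
      add_mem' := by
        intro a b ha hb
        change Ψ (a + b) 1 = 0
        rw [map_add, LinearMap.add_apply, show Ψ a 1 = 0 from ha, show Ψ b 1 = 0 from hb, add_zero]
      smul_mem' := by
        intro z a ha
        change Ψ (z • a) 1 = 0
        rw [hsmul, LinearMap.smul_apply, show Ψ a 1 = 0 from ha, smul_zero] }
  have hle : lowerClosure r (detV d r p ^ ν • vac d r) ≤ S := by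
    refine sInf_le ⟨?_, fun m n hmn w hw => ?_⟩
    · change Ψ _ 1 = 0
      obtain ⟨ν, rfl⟩ := Nat.exists_eq_add_of_le' hν
      rw [pow_succ', mul_smul, hΨ, ← traceExp_zero (d := d) (p := p)]
      exact uDualAction_detV_one r hp _
    · change Ψ (UniversalEnvelopingAlgebra.ι ℂ (v (d := d) r m n) • w) 1 = 0
      rw [hΨ]
      exact uDualAction_v_one (Ψ w) hmn hw
  intro h
  have h1 : Ψ (vac d r) 1 = 0 := hle h
  rw [hvac, ← map_one MvPolynomial.C, constFun_C] at h1
  exact one_ne_zero h1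

/-- The closure of the singular vector, intersected with `M_r^{(1)}`, is a submodule that contains a
nonzero vector but not the vacuum. -/
theorem not_isIrreducible_Mr1 (ν : ℕ) (hp : 1 ≤ p) (hν : 1 ≤ ν) (h : r - p + 2 * ν - 1 = 0) :
    ¬ LieModule.IsIrreducible ℂ (Lr1 d r) (Mr1 d r) := by
  intro hirr
  set u := detV d r p ^ ν • vac d r with hu_def
  have hu : ∀ m n : ℤ, 0 < m + n → opV r m n u = 0 := (isSingular_detV_pow r ν hp hν h).2.2.2
  let N : LieSubmodule ℂ (Lr1 d r) (Mr1 d r) :=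
    { (lowerClosure r u).comap ((Mr1 d r).toSubmodule.subtype) with
      lie_mem := fun {x w} hw => lie_mem_lowerClosure hu x.2 hw }
  rcases hirr.eq_bot_or_eq_top N with h0 | h1
  · have : (⟨u, detV_pow_vac_mem r ν⟩ : Mr1 d r) ∈ N := mem_lowerClosure u
    rw [h0, LieSubmodule.mem_bot] at this
    exact detV_pow_vac_ne_zero r ν (congrArg Subtype.val this)
  · have : (⟨vac d r, vac_mem_Mr1 r⟩ : Mr1 d r) ∈ N := h1 ▸ LieSubmodule.mem_top _
    exact vac_not_mem_lowerClosure ν hp hν this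

end Singular

end

end JordanVOA

theorem proposition6p1 (d : ℕ) [NeZero d] (hd : 2 ≤ d) (r : ℤ) (p ν : ℕ) (hp : 1 ≤ p) (hν : 1 ≤ ν)
    (h : r = 1 - 2 * (ν : ℤ) + (p : ℤ)) :
    JordanVOA.IsSingular (JordanVOA.detV d (r : ℂ) p ^ ν • JordanVOA.vac d (r : ℂ)) ∧
    ¬ LieModule.IsIrreducible ℂ (JordanVOA.Lr1 d (r : ℂ)) (JordanVOA.Mr1 d (r : ℂ)) := by
  have hr : (r : ℂ) - p + 2 * ν - 1 = 0 := by
    rw [h]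
    push_cast
    ring
  exact ⟨JordanVOA.isSingular_detV_pow _ ν hp hν hr, JordanVOA.not_isIrreducible_Mr1 ν hp hν hr⟩
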